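/- **Setting.** Let $W\in C^2(0,\infty)$ be nonnegative with $W(F)\to\infty$ as $F\searrow0$, $W(F)\to\gamma>0$ as $F\to\infty$, $W(1)=0$ and $W(F)>0$ for $F\ne1$. Put $W^*(H)=H\,W(1/H)$ for $H>0$ and $W^*(0)=0$, and assume $W^*\in C^2([0,\infty))$; write $S^*=dW^*/dH$ and $M^*=dS^*/dH$. Let $\epsilon,\lambda>0$, let $$\mathcal K=\{h\in H^2(0,\lambda):h(0)=0,\ h(\lambda)=1,\ h'\ge0\},\qquad E[h]=\int_0^\lambda\Big(\tfrac{\epsilon^2}{2}(h'')^2+W^*(h')\Big)dy .$$ For $h\in\mathcal K$ let $\mathcal B_h=\{y\in[0,\lambda]:h'(y)=0\}$, $\mathcal G_h=[0,\lambda]\setminus\mathcal B_h$, and let $\mathcal C_h$ be the set of crack faces, i.e. of the points $y_c\in\mathcal B_h$ such that $h'$ does not vanish identically on $[y_c-\alpha,y_c+\alpha]\cap[0,\lambda]$ for any $\alpha>0$. Assume that no crack face is degenerate: for every $y_c\in\mathcal C_h$ there is $\alpha>0$ with $[y_c,y_c+\alpha)\subseteq\mathcal B_h$ and $(y_c-\alpha,y_c)\subseteq\mathcal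 G_h$, or with $(y_c-\alpha,y_c]\subseteq\mathcal B_h$ and $(y_c,y_c+\alpha)\subseteq\mathcal G_h$. Let $h\in\mathcal K$ solve the Euler–Lagrange equation, i.e. there is a nonnegative Radon measure $\mu$ with $\operatorname{supp}\mu\subseteq\mathcal B_h$ and $$\int_0^\lambda\big(\epsilon^2h''\psi''+S^*(h')\psi'\big)dy=\int_{\mathcal B_h}\psi'\,d\mu\qquad\text{for all }\psi\in H^2(0,\lambda)\cap H^1_0(0,\lambda).$$ The admissible variations at $h$ (those compatible with $h'\ge0$ and with the irreversibility of cracks) are $$\mathcal V_h=\{\eta\in H^2(0,\lambda)\cap H^1_0(0,\lambda):\eta'\ge0\text{ on }\mathcal B_h,\ \eta=0\text{ on }\mathcal C_h\},$$ and $\mathcal S_h=\{\eta\in\mathcal V_h:\eta=\eta'=0\text{ on }\mathcal B_h\}$. The second variation is $\delta^2E[h;\eta,\eta]=\int_0^\lambda\big(\epsilon^2(\eta'')^2+M^*(h')(\eta')^2\big)dy$. We call $h$ locally stable if it is a local minimizer of $E$ under admissible variations: there is $\delta>0$ such that $E[g]\ge E[h]$ for all $g\in\mathcal K$ with $g-h\in\mathcal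 V_h$ and $\|g-h\|_{H^2(0,\lambda)}<\delta$. **Theorem (sufficient condition).** Let $G_i=(r_i,s_i)\subseteq\mathcal G_h$, $i=1,\dots,N$ ($N\ge 0$), be all the unbroken intervals with both end points $r_i<s_i$ in $\mathcal C_h$, and let $\xi_i$ equal $h'$ on $G_i$ and $0$ on $[0,\lambda]\setminus G_i$. Then $\xi_i\in\mathcal S_h$ for every $i$. If $\delta^2E[h;\eta,\eta]>0$ for all nonzero $\eta\in\mathcal S_h$ with $\int_0^\lambda\eta\,\xi_i\,dy=0$ for all $i=1,\dots,N$, then $h$ is locally stable. -/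

import Mathlib

open Set Filter Topology MeasureTheory

noncomputable section

namespace InverseFracture

/-! ### The stored energy and its inverse-deformation counterpart -/

/-- A stored-energy density of a brittle material: `W : (0,∞) → [0,∞)` is `C²`, blows up at `0`,
tends to `γ > 0` at infinity, and vanishes exactly at `F = 1`. -/
structure IsBrittleEnergy (W : ℝ → ℝ) (γ : ℝ) : Prop where
  contDiffOn : ContDiffOn ℝ 2 W (Ioi 0)
  tendsto_zero : Tendsto W (𝓝[>] 0) atTop
  gamma_pos : 0 < γ
  tendsto_top : Tendsto W atTop (𝓝 γ)
  one : W 1 = 0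
  pos : ∀ F, 0 < F → F ≠ 1 → 0 < W F

/-- `W*(H) = H W(1/H)` for `H > 0`, with the continuous extension `W*(0) = 0`. -/
def Wstar (W : ℝ → ℝ) (H : ℝ) : ℝ := H * W (1 / H)

/-- `S* = dW*/dH` on `[0,∞)` (one-sided at `0`). -/
def Sstar (W : ℝ → ℝ) : ℝ → ℝ := derivWithin (Wstar W) (Ici 0)

/-- `M* = dS*/dH` on `[0,∞)` (one-sided at `0`). -/
def Mstar (W : ℝ → ℝ) : ℝ → ℝ := derivWithin (Sstar W) (Ici 0)

/-! ### The Sobolev space `H²(0,L)`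

Functions are total functions `ℝ → ℝ` of which only the values on `[0,L]` matter. -/

/-- The derivative on `[0,L]` (one-sided at the end points). -/
def D (L : ℝ) (f : ℝ → ℝ) : ℝ → ℝ := derivWithin f (Icc 0 L)

/-- `f ∈ H²(0,L)`, for the `C¹` representative: `f` is differentiable on `[0,L]`, `f'` is absolutely
continuous, and its (almost everywhere defined) derivative `f''` is square integrable. -/
structure MemH2 (L : ℝ) (f : ℝ → ℝ) : Prop where
  differentiableOn : DifferentiableOn ℝ f (Icc 0 L)
  absolutelyContinuous : AbsolutelyContinuousOnInterval (D L f) 0 L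
  memLp : MemLp (D L (D L f)) 2 (volume.restrict (Icc 0 L))

/-- The norm of `H²(0,L)`. -/
def H2norm (L : ℝ) (f : ℝ → ℝ) : ℝ :=
  √(∫ y in (0 : ℝ)..L, (f y ^ 2 + D L f y ^ 2 + D L (D L f) y ^ 2))

/-- `H²(0,L) ∩ H¹₀(0,L)`. -/
def H2H10 (L : ℝ) : Set (ℝ → ℝ) := {ψ | MemH2 L ψ ∧ ψ 0 = 0 ∧ ψ L = 0}

/-! ### Admissible inverse deformations and cracks -/

/-- The admissible set `K`: `h ∈ H²(0,L)`, `h(0) = 0`, `h(L) = 1`, `h' ≥ 0`. -/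
def K (L : ℝ) : Set (ℝ → ℝ) :=
  {h | MemH2 L h ∧ h 0 = 0 ∧ h L = 1 ∧ ∀ y ∈ Icc 0 L, 0 ≤ D L h y}

/-- The total energy `∫₀ᴸ (ε²/2) (h'')² + W*(h')`. -/
def energy (W : ℝ → ℝ) (ε L : ℝ) (h : ℝ → ℝ) : ℝ :=
  ∫ y in (0 : ℝ)..L, (ε ^ 2 / 2 * D L (D L h) y ^ 2 + Wstar W (D L h y))

/-- The broken set `B_h = {y ∈ [0,L] : h'(y) = 0}`. -/
def broken (L : ℝ) (h : ℝ → ℝ) : Set ℝ := {y | y ∈ Icc 0 L ∧ D L h y = 0}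

/-- The good set `G_h = [0,L] \ B_h`. -/
def good (L : ℝ) (h : ℝ → ℝ) : Set ℝ := Icc 0 L \ broken L h

/-- The set `C_h` of crack faces: points of the broken set with no neighbourhood (in `[0,L]`) on
which `h'` vanishes. -/
def crackFaces (L : ℝ) (h : ℝ → ℝ) : Set ℝ :=
  {y | y ∈ broken L h ∧ ¬ ∃ α > 0, Icc (y - α) (y + α) ∩ Icc 0 L ⊆ broken L h}

/-- No crack face is degenerate: each one has a broken interval on one side and an unbroken
interval on the other side. -/
def NondegenerateCracks (L : ℝ) (h : ℝ → ℝ) : Prop :=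
  ∀ y ∈ crackFaces L h, ∃ α > 0,
    (Ico y (y + α) ⊆ broken L h ∧ Ioo (y - α) y ⊆ good L h) ∨
    (Ioc (y - α) y ⊆ broken L h ∧ Ioo y (y + α) ⊆ good L h)

/-- `h` solves the Euler-Lagrange equation: there is a nonnegative Radon measure `μ` carried by the
(compact) broken set with
`∫₀ᴸ ε² h'' ψ'' + S*(h') ψ' = ∫_{B_h} ψ' dμ` for all `ψ ∈ H²(0,L) ∩ H¹₀(0,L)`. -/
def SolvesEL (W : ℝ → ℝ) (ε L : ℝ) (h : ℝ → ℝ) : Prop :=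
  ∃ μ : Measure ℝ, IsFiniteMeasure μ ∧ μ (broken L h)ᶜ = 0 ∧
    ∀ ψ ∈ H2H10 L,
      ∫ y in (0 : ℝ)..L, (ε ^ 2 * D L (D L h) y * D L (D L ψ) y + Sstar W (D L h y) * D L ψ y)
        = ∫ y in broken L h, D L ψ y ∂μ

/-! ### Admissible variations and stability -/

/-- The space `V_h` of admissible variations: `η' ≥ 0` on the broken set (orientation), and `η = 0`
at the crack faces (irreversibility). -/
def admissibleVariations (L : ℝ) (h : ℝ → ℝ) : Set (ℝ → ℝ) :=
  {η | η ∈ H2H10 L ∧ (∀ y ∈ broken L h, 0 ≤ D L η y) ∧ ∀ y ∈ crackFaces L h, η y = 0}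

/-- The space `S_h` of those admissible variations with `η' = 0` and `η = 0` on the broken set. -/
def restrictedVariations (L : ℝ) (h : ℝ → ℝ) : Set (ℝ → ℝ) :=
  {η | η ∈ admissibleVariations L h ∧ (∀ y ∈ broken L h, D L η y = 0) ∧
    ∀ y ∈ broken L h, η y = 0}

/-- The second variation of the energy at `h` in the direction `η`. -/
def secondVariation (W : ℝ → ℝ) (ε L : ℝ) (h η : ℝ → ℝ) : ℝ :=
  ∫ y in (0 : ℝ)..L, (ε ^ 2 * D L (D L η) y ^ 2 + Mstar W (D L h y) * D L η y ^ 2)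

/-- `(r,s)` is an unbroken part of the bar bounded by two crack faces. -/
def IsUnbrokenPart (L : ℝ) (h : ℝ → ℝ) (r s : ℝ) : Prop :=
  r ∈ crackFaces L h ∧ s ∈ crackFaces L h ∧ r < s ∧ Ioo r s ⊆ good L h

/-- The translation mode of the part `(r,s)`: `h'` on `(r,s)` and zero elsewhere. -/
def translationMode (L : ℝ) (h : ℝ → ℝ) (r s : ℝ) : ℝ → ℝ := (Ioo r s).indicator (D L h)

/-- Local stability: `h` minimizes the energy among all `g ∈ K` in an `H²`-ball around `h` that are
reached from `h` by an admissible variation. (A ball of `H²` meets `K` in a convex, relatively open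
set, and every relatively open set around `h` contains such a set.) -/
def LocallyStable (W : ℝ → ℝ) (ε L : ℝ) (h : ℝ → ℝ) : Prop :=
  ∃ δ > 0, ∀ g ∈ K L, g - h ∈ admissibleVariations L h → H2norm L (g - h) < δ →
    energy W ε L h ≤ energy W ε L g

end InverseFracture

end

/-!
An admissible variation vanishes at the ends of the bar and at the crack faces, and its slope
vanishes on the broken intervals. There are finitely many crack faces, since none is degenerate, so
the energy difference splits into one term for each interval between consecutive such points; broken
intervals contribute nothing.

On an unbroken interval `(a,b)`, testing the Euler-Lagrange equation with the primitive of `q - h'`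
shows that the energy of a competing slope `q` exceeds that of `h` by at least half of a second
variation, with `M*` evaluated near `h'`. If `h` were not stable, normalizing the differences
`q - h'` for competitors `q → h'` and passing to a weak limit in `H¹` would give a nonzero `η ∈ S_h`
with nonpositive second variation.

When `a` and `b` are both crack faces, `η` must moreover be orthogonal to the translation mode. The
broken intervals next to `a` and `b` leave room to translate the competitor without changing its
energy, and by the intermediate value theorem some small translation achieves orthogonality. The
translation mode itself lies in `S_h` because translating `h'` costs no energy: comparing `h` with
its own translates bounds the difference quotients of `h''` in `L²`.
-/

noncomputable section

namespace InverseFracture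

/-! ### Interval integrals of square integrable functions -/

section L2

variable {a b x y : ℝ} {f g : ℝ → ℝ}

lemma intervalIntegral_eq_restrict_Icc (hab : a ≤ b) (f : ℝ → ℝ) :
    ∫ y in a..b, f y = ∫ y, f y ∂(volume.restrict (Icc a b)) := by
  rw [intervalIntegral.integral_of_le hab, integral_Icc_eq_integral_Ioc]

lemma intervalIntegrable_of_integrableOn_Icc (hf : IntegrableOn f (Icc a b)) (hx : x ∈ Icc a b)
    (hy : y ∈ Icc a b) : IntervalIntegrable f volume x y :=
  intervalIntegrable_iff.2 (hf.mono_set (uIoc_subset_uIcc.trans (uIcc_subset_Icc hx hy)))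

lemma intervalIntegrable_of_memLp_Icc (hf : MemLp f 2 (volume.restrict (Icc a b)))
    (hx : x ∈ Icc a b) (hy : y ∈ Icc a b) : IntervalIntegrable f volume x y :=
  intervalIntegrable_of_integrableOn_Icc (hf.integrable one_le_two) hx hy

lemma intervalIntegrable_sq_of_memLp_Icc (hf : MemLp f 2 (volume.restrict (Icc a b)))
    (hx : x ∈ Icc a b) (hy : y ∈ Icc a b) : IntervalIntegrable (fun y => f y ^ 2) volume x y :=
  intervalIntegrable_of_integrableOn_Icc hf.integrable_sq hx hy

lemma intervalIntegrable_mul_of_memLp_Icc (hab : a ≤ b)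
    (hf : MemLp f 2 (volume.restrict (Icc a b))) (hg : MemLp g 2 (volume.restrict (Icc a b))) :
    IntervalIntegrable (fun y => f y * g y) volume a b :=
  intervalIntegrable_of_integrableOn_Icc (hf.integrable_mul hg) (left_mem_Icc.2 hab)
    (right_mem_Icc.2 hab)

lemma sq_integral_le_mul_integral_sq (hab : a ≤ b) (hf : IntervalIntegrable f volume a b)
    (hf2 : IntervalIntegrable (fun y => f y ^ 2) volume a b) :
    (∫ y in a..b, f y) ^ 2 ≤ (b - a) * ∫ y in a..b, f y ^ 2 := by
  have hquad (c : ℝ) :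
      0 ≤ (b - a) * (c * c) + -2 * (∫ y in a..b, f y) * c + ∫ y in a..b, f y ^ 2 :=
    calc (0 : ℝ) ≤ ∫ y in a..b, (f y - c) ^ 2 :=
          intervalIntegral.integral_nonneg hab fun _ _ => sq_nonneg _
      _ = ∫ y in a..b, (f y ^ 2 - 2 * c * f y + c * c) :=
          intervalIntegral.integral_congr fun y _ => by ring
      _ = _ := by
          rw [intervalIntegral.integral_add (hf2.sub (hf.const_mul _)) intervalIntegrable_const,
            intervalIntegral.integral_sub hf2 (hf.const_mul _),
            intervalIntegral.integral_const_mul, intervalIntegral.integral_const, smul_eq_mul]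
          ring
  have hdiscrim := discrim_le_zero hquad
  rw [discrim] at hdiscrim
  linarith

end L2

/-! ### The space `H¹(0,L)` -/

/-- `q ∈ H¹(0,L)` with weak derivative `z`: on `[0,L]`, `q` is a primitive of the square integrable
function `z`. Slopes `h'` of deformations `h ∈ H²(0,L)` are handled as such pairs `(h', h'')`. -/
structure MemH1 (L : ℝ) (q z : ℝ → ℝ) : Prop where
  memLp : MemLp z 2 (volume.restrict (Icc 0 L))
  eq_add_integral : ∀ y ∈ Icc 0 L, q y = q 0 + ∫ t in (0 : ℝ)..y, z t

namespace MemH1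

variable {L x y : ℝ} {q z q' z' : ℝ → ℝ}

lemma intervalIntegrable_deriv (hq : MemH1 L q z) (hx : x ∈ Icc 0 L) (hy : y ∈ Icc 0 L) :
    IntervalIntegrable z volume x y :=
  intervalIntegrable_of_memLp_Icc hq.memLp hx hy

lemma intervalIntegrable_deriv_sq (hq : MemH1 L q z) (hx : x ∈ Icc 0 L) (hy : y ∈ Icc 0 L) :
    IntervalIntegrable (fun t => z t ^ 2) volume x y :=
  intervalIntegrable_sq_of_memLp_Icc hq.memLp hx hy

lemma continuousOn (hL : 0 ≤ L) (hq : MemH1 L q z) : ContinuousOn q (Icc 0 L) := by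
  have hprim := intervalIntegral.continuousOn_primitive_interval'
    (hq.intervalIntegrable_deriv (left_mem_Icc.2 hL) (right_mem_Icc.2 hL)) left_mem_uIcc
  rw [uIcc_of_le hL] at hprim
  exact (continuousOn_const.add hprim).congr hq.eq_add_integral

lemma intervalIntegrable_sq (hL : 0 ≤ L) (hq : MemH1 L q z) :
    IntervalIntegrable (fun y => q y ^ 2) volume 0 L :=
  ((hq.continuousOn hL).pow 2).intervalIntegrable_of_Icc hL

lemma sub (hq : MemH1 L q z) (hq' : MemH1 L q' z') :
    MemH1 L (fun y => q y - q' y) (fun y => z y - z' y) := by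
  refine ⟨hq.memLp.sub hq'.memLp, fun y hy => ?_⟩
  have h0 : (0 : ℝ) ∈ Icc 0 L := ⟨le_rfl, hy.1.trans hy.2⟩
  rw [intervalIntegral.integral_sub (hq.intervalIntegrable_deriv h0 hy)
    (hq'.intervalIntegrable_deriv h0 hy), hq.eq_add_integral y hy, hq'.eq_add_integral y hy]
  ring

lemma const_mul (c : ℝ) (hq : MemH1 L q z) :
    MemH1 L (fun y => c * q y) (fun y => c * z y) := by
  refine ⟨hq.memLp.const_mul c, fun y hy => ?_⟩
  rw [intervalIntegral.integral_const_mul, hq.eq_add_integral y hy, mul_add]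

lemma sub_eq_integral (hq : MemH1 L q z) (hx : x ∈ Icc 0 L) (hy : y ∈ Icc 0 L) :
    q y - q x = ∫ t in x..y, z t := by
  have h0 : (0 : ℝ) ∈ Icc 0 L := ⟨le_rfl, hx.1.trans hx.2⟩
  rw [hq.eq_add_integral y hy, hq.eq_add_integral x hx, add_sub_add_left_eq_sub,
    intervalIntegral.integral_interval_sub_left (hq.intervalIntegrable_deriv h0 hy)
      (hq.intervalIntegrable_deriv h0 hx)]

lemma sq_sub_le (hq : MemH1 L q z) (hx : x ∈ Icc 0 L) (hy : y ∈ Icc 0 L) :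
    (q y - q x) ^ 2 ≤ L * ∫ t in (0 : ℝ)..L, z t ^ 2 := by
  wlog hxy : x ≤ y generalizing x y
  · rw [← neg_sub, neg_sq]
    exact this hy hx (le_of_not_ge hxy)
  have hL : 0 ≤ L := hx.1.trans hx.2
  calc (q y - q x) ^ 2 = (∫ t in x..y, z t) ^ 2 := by rw [hq.sub_eq_integral hx hy]
    _ ≤ (y - x) * ∫ t in x..y, z t ^ 2 :=
        sq_integral_le_mul_integral_sq hxy (hq.intervalIntegrable_deriv hx hy)
          (hq.intervalIntegrable_deriv_sq hx hy)
    _ ≤ L * ∫ t in (0 : ℝ)..L, z t ^ 2 := by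
        refine mul_le_mul (by linarith [hx.1, hy.2]) ?_
          (intervalIntegral.integral_nonneg hxy fun _ _ => sq_nonneg _) hL
        exact intervalIntegral.integral_mono_interval hx.1 hxy hy.2
          (Eventually.of_forall fun _ => sq_nonneg _)
          (hq.intervalIntegrable_deriv_sq (left_mem_Icc.2 hL) (right_mem_Icc.2 hL))

lemma mul_sq_le (hq : MemH1 L q z) (hy : y ∈ Icc 0 L) :
    L * q y ^ 2 ≤ 2 * (∫ t in (0 : ℝ)..L, q t ^ 2) + 2 * L ^ 2 * ∫ t in (0 : ℝ)..L, z t ^ 2 := by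
  have hL : 0 ≤ L := hy.1.trans hy.2
  set A := ∫ t in (0 : ℝ)..L, z t ^ 2
  have hsq := (hq.intervalIntegrable_sq hL).const_mul 2
  calc L * q y ^ 2 = ∫ _ in (0 : ℝ)..L, q y ^ 2 := by simp
    _ ≤ ∫ t in (0 : ℝ)..L, (2 * q t ^ 2 + 2 * (L * A)) := by
        refine intervalIntegral.integral_mono_on hL intervalIntegrable_const
          (hsq.add intervalIntegrable_const) fun t ht => ?_
        nlinarith [hq.sq_sub_le ht hy, sq_nonneg (q y - 2 * q t)]
    _ = 2 * (∫ t in (0 : ℝ)..L, q t ^ 2) + 2 * L ^ 2 * A := by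
        rw [intervalIntegral.integral_add hsq intervalIntegrable_const,
          intervalIntegral.integral_const_mul, intervalIntegral.integral_const, smul_eq_mul]
        ring

end MemH1

section H2

variable {L x y : ℝ} {f g q z : ℝ → ℝ}

namespace MemH2

lemma hasDerivWithinAt (hf : MemH2 L f) (hy : y ∈ Icc 0 L) :
    HasDerivWithinAt f (D L f y) (Icc 0 L) y :=
  (hf.differentiableOn y hy).hasDerivWithinAt

lemma memH1_D (hf : MemH2 L f) : MemH1 L (D L f) (D L (D L f)) := by
  refine ⟨hf.memLp, fun y hy => ?_⟩
  have hac : AbsolutelyContinuousOnInterval (D L f) 0 y :=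
    hf.absolutelyContinuous.mono
      (uIcc_subset_uIcc left_mem_uIcc (by rwa [uIcc_of_le (hy.1.trans hy.2)]))
  have hderiv : ∫ t in (0 : ℝ)..y, D L (D L f) t = ∫ t in (0 : ℝ)..y, deriv (D L f) t := by
    refine intervalIntegral.integral_congr_ae ?_
    filter_upwards [Measure.ae_ne volume y] with t hty ht
    rw [uIoc_of_le hy.1] at ht
    exact derivWithin_of_mem_nhds (Icc_mem_nhds ht.1 ((lt_of_le_of_ne ht.2 hty).trans_le hy.2))
  rw [hderiv, hac.integral_deriv_eq_sub, add_sub_cancel]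

lemma continuousOn_D (hL : 0 ≤ L) (hf : MemH2 L f) : ContinuousOn (D L f) (Icc 0 L) :=
  hf.memH1_D.continuousOn hL

lemma sub_eq_integral_D (hf : MemH2 L f) (hx : x ∈ Icc 0 L) (hy : y ∈ Icc 0 L) :
    f y - f x = ∫ t in x..y, D L f t := by
  have hs : uIcc x y ⊆ Icc 0 L := uIcc_subset_Icc hx hy
  symm
  refine intervalIntegral.integral_eq_sub_of_hasDeriv_right
    (hf.differentiableOn.continuousOn.mono hs) (fun t ht => ?_)
    ((hf.continuousOn_D (hx.1.trans hx.2)).mono hs).intervalIntegrable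
  have ht0 : 0 < t := (le_min hx.1 hy.1).trans_lt ht.1
  have htL : t < L := ht.2.trans_le (max_le hx.2 hy.2)
  exact ((hf.hasDerivWithinAt ⟨ht0.le, htL.le⟩).hasDerivAt
    (Icc_mem_nhds ht0 htL)).hasDerivWithinAt

lemma D_sub (hf : MemH2 L f) (hg : MemH2 L g) (hy : y ∈ Icc 0 L) :
    D L (f - g) y = D L f y - D L g y :=
  derivWithin_sub (hf.differentiableOn y hy) (hg.differentiableOn y hy)

end MemH2

lemma D_congr (hfg : EqOn f g (Icc 0 L)) : EqOn (D L f) (D L g) (Icc 0 L) :=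
  fun _ hy => derivWithin_congr hfg (hfg hy)

lemma hasDerivWithinAt_primitive (hq : ContinuousOn q (Icc 0 L)) (hy : y ∈ Icc 0 L) :
    HasDerivWithinAt (fun x => ∫ t in (0 : ℝ)..x, q t) (q y) (Icc 0 L) y := by
  have : Fact (y ∈ Icc (0 : ℝ) L) := ⟨hy⟩
  refine intervalIntegral.integral_hasDerivWithinAt_right (t := Icc 0 L)
    ((hq.mono (Icc_subset_Icc_right hy.2)).intervalIntegrable_of_Icc hy.1) ?_ (hq y hy)
  exact ⟨Icc 0 L, self_mem_nhdsWithin, hq.aestronglyMeasurable measurableSet_Icc⟩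

lemma D_primitive (hL : 0 < L) (hq : ContinuousOn q (Icc 0 L)) :
    EqOn (D L fun x => ∫ t in (0 : ℝ)..x, q t) q (Icc 0 L) :=
  fun y hy => (hasDerivWithinAt_primitive hq hy).derivWithin (uniqueDiffOn_Icc hL y hy)

lemma MemH1.D_ae_eq (hL : 0 < L) (hq : MemH1 L q z) :
    D L q =ᵐ[volume.restrict (Icc 0 L)] z := by
  have hi := hq.intervalIntegrable_deriv (left_mem_Icc.2 hL.le) (right_mem_Icc.2 hL.le)
  rw [EventuallyEq, ae_restrict_iff' measurableSet_Icc]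
  filter_upwards [hi.ae_hasDerivAt_integral] with y hy hyL
  have hd := (hy (by rwa [uIcc_of_le hL.le]) 0 left_mem_uIcc).const_add (q 0)
  rw [D_congr hq.eq_add_integral hyL]
  exact hd.hasDerivWithinAt.derivWithin (uniqueDiffOn_Icc hL y hyL)

lemma MemH1.absolutelyContinuous (hL : 0 ≤ L) (hq : MemH1 L q z) :
    AbsolutelyContinuousOnInterval q 0 L := by
  have hconst : AbsolutelyContinuousOnInterval (fun _ : ℝ => q 0) 0 L :=
    (LipschitzWith.const (q 0)).lipschitzOnWith.absolutelyContinuousOnInterval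
  have hsum := hconst.fun_add ((hq.intervalIntegrable_deriv (left_mem_Icc.2 hL)
    (right_mem_Icc.2 hL)).absolutelyContinuousOnInterval_intervalIntegral left_mem_uIcc)
  rw [absolutelyContinuousOnInterval_iff] at hsum ⊢
  intro e he
  obtain ⟨d, hd, hlt⟩ := hsum e he
  refine ⟨d, hd, fun E hE hEd => lt_of_eq_of_lt (Finset.sum_congr rfl fun i hi => ?_)
    (hlt E hE hEd)⟩
  have hmem := hE.1 i (by simpa using hi)
  rw [uIcc_of_le hL] at hmem
  rw [← hq.eq_add_integral _ hmem.1, ← hq.eq_add_integral _ hmem.2]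

namespace MemH1

lemma memH2_of_eqOn_primitive (hL : 0 < L) (hq : MemH1 L q z)
    (hf : EqOn f (fun x => ∫ t in (0 : ℝ)..x, q t) (Icc 0 L)) : MemH2 L f := by
  have hqc := hq.continuousOn hL.le
  have hD : EqOn (D L f) q (Icc 0 L) := (D_congr hf).trans (D_primitive hL hqc)
  have hq' : MemH1 L (D L f) z := by
    refine ⟨hq.memLp, fun y hy => ?_⟩
    rw [hD hy, hD (left_mem_Icc.2 hL.le), hq.eq_add_integral y hy]
  exact ⟨fun y hy =>
    ((hasDerivWithinAt_primitive hqc hy).congr hf (hf hy)).differentiableWithinAt,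
    hq'.absolutelyContinuous hL.le, hq.memLp.ae_eq (hq'.D_ae_eq hL).symm⟩

lemma D_D_primitive (hL : 0 < L) (hq : MemH1 L q z) :
    D L (D L fun x => ∫ t in (0 : ℝ)..x, q t) =ᵐ[volume.restrict (Icc 0 L)] z := by
  refine EventuallyEq.trans ?_ (hq.D_ae_eq hL)
  filter_upwards [ae_restrict_mem measurableSet_Icc] with y hy
  exact D_congr (D_primitive hL (hq.continuousOn hL.le)) hy

end MemH1

end H2

/-! ### Weak sequential compactness -/

section WeakCompactness

variable {E : Type*} [NormedAddCommGroup E] [InnerProductSpace ℝ E] {u : ℕ → E} {w : E} {R a : ℝ}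

lemma exists_subseq_tendsto_inner [CompleteSpace E] [TopologicalSpace.SeparableSpace E]
    (hu : ∀ n, ‖u n‖ ≤ R) :
    ∃ (w : E) (σ : ℕ → ℕ), StrictMono σ ∧
      ∀ v, Tendsto (fun n => inner ℝ (u (σ n)) v) atTop (𝓝 (inner ℝ w v)) := by
  have hball (n : ℕ) : StrongDual.toWeakDual (InnerProductSpace.toDual ℝ E (u n)) ∈
      WeakDual.toStrongDual ⁻¹' Metric.closedBall (0 : StrongDual ℝ E) R := by
    rw [mem_preimage, mem_closedBall_zero_iff]
    exact ((InnerProductSpace.toDual ℝ E).norm_map (u n)).trans_le (hu n)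
  obtain ⟨ℓ, -, σ, hσ, hℓ⟩ := WeakDual.isSeqCompact_closedBall ℝ E 0 R hball
  refine ⟨(InnerProductSpace.toDual ℝ E).symm (WeakDual.toStrongDual ℓ), σ, hσ, fun v => ?_⟩
  rw [InnerProductSpace.toDual_symm_apply]
  exact ((WeakDual.eval_continuous v).tendsto ℓ).comp hℓ

lemma norm_sq_le_of_tendsto_inner (hu : Tendsto (fun n => inner ℝ (u n) w) atTop (𝓝 (inner ℝ w w)))
    {A : ℕ → ℝ} (hA : Tendsto A atTop (𝓝 a)) (hle : ∀ n, ‖u n‖ ^ 2 ≤ A n) : ‖w‖ ^ 2 ≤ a := by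
  have hlim := (hu.const_mul 2).sub_const (‖w‖ ^ 2)
  rw [real_inner_self_eq_norm_sq, two_mul, add_sub_cancel_right] at hlim
  refine le_of_tendsto_of_tendsto' hlim hA fun n => le_trans ?_ (hle n)
  linarith [norm_sub_sq_real (u n) w, sq_nonneg ‖u n - w‖]

lemma norm_toLp_sq {α : Type*} [MeasurableSpace α] {μ : Measure α} {f : α → ℝ}
    (hf : MemLp f 2 μ) : ‖hf.toLp f‖ ^ 2 = ∫ x, f x ^ 2 ∂μ := by
  rw [← real_inner_self_eq_norm_sq, L2.inner_def]
  refine integral_congr_ae ?_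
  filter_upwards [hf.coeFn_toLp] with x hx
  rw [hx, real_inner_self_eq_norm_sq, Real.norm_eq_abs, sq_abs]

lemma exists_subseq_tendsto_setIntegral {α : Type*} [MeasurableSpace α] {μ : Measure α}
    [TopologicalSpace.SeparableSpace (Lp ℝ 2 μ)] {z : ℕ → α → ℝ} {C : ℝ}
    (hz : ∀ n, MemLp (z n) 2 μ) (hC : ∀ n, ∫ x, z n x ^ 2 ∂μ ≤ C) :
    ∃ (w : α → ℝ) (σ : ℕ → ℕ), MemLp w 2 μ ∧ StrictMono σ ∧
      (∀ s, MeasurableSet s → μ s ≠ ⊤ →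
        Tendsto (fun n => ∫ x in s, z (σ n) x ∂μ) atTop (𝓝 (∫ x in s, w x ∂μ))) ∧
      ∀ (A : ℕ → ℝ) (a : ℝ), Tendsto A atTop (𝓝 a) →
        (∀ n, ∫ x, z (σ n) x ^ 2 ∂μ ≤ A n) → ∫ x, w x ^ 2 ∂μ ≤ a := by
  have hbound (n : ℕ) : ‖(hz n).toLp (z n)‖ ≤ √C :=
    Real.le_sqrt_of_sq_le ((norm_toLp_sq (hz n)).trans_le (hC n))
  obtain ⟨w, σ, hσ, hw⟩ := exists_subseq_tendsto_inner hbound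
  refine ⟨w, σ, Lp.memLp w, hσ, fun s hs hμs => ?_, fun A a hA hle => ?_⟩
  · have hpair (f : Lp ℝ 2 μ) :
        inner ℝ f (indicatorConstLp 2 hs hμs (1 : ℝ)) = ∫ x in s, f x ∂μ := by
      rw [real_inner_comm, L2.inner_indicatorConstLp_one]
    have hlim := hw (indicatorConstLp 2 hs hμs (1 : ℝ))
    simp only [hpair] at hlim
    refine hlim.congr fun n => integral_congr_ae ?_
    exact ae_restrict_of_ae (hz (σ n)).coeFn_toLp
  · rw [← norm_toLp_sq (Lp.memLp w), Lp.toLp_coeFn]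
    exact norm_sq_le_of_tendsto_inner (hw w) hA fun n => (norm_toLp_sq (hz (σ n))).trans_le (hle n)

lemma exists_subseq_memH1 {L C : ℝ} (hL : 0 ≤ L) {q z : ℕ → ℝ → ℝ}
    (hq : ∀ n, MemH1 L (q n) (z n)) (h0 : ∀ n, |q n 0| ≤ C)
    (hz : ∀ n, ∫ t in (0 : ℝ)..L, z n t ^ 2 ≤ C) :
    ∃ (σ : ℕ → ℕ) (p w : ℝ → ℝ), StrictMono σ ∧ MemH1 L p w ∧
      (∀ y ∈ Icc 0 L, Tendsto (fun n => q (σ n) y) atTop (𝓝 (p y))) ∧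
      ∀ (A : ℕ → ℝ) (a : ℝ), Tendsto A atTop (𝓝 a) →
        (∀ n, ∫ t in (0 : ℝ)..L, z (σ n) t ^ 2 ≤ A n) → ∫ t in (0 : ℝ)..L, w t ^ 2 ≤ a := by
  have : Fact ((2 : ENNReal) ≠ ⊤) := ⟨by norm_num⟩
  obtain ⟨c, -, σ₁, hσ₁, hc⟩ := (isCompact_Icc (a := -C) (b := C)).tendsto_subseq
    (x := fun n => q n 0) (fun n => abs_le.1 (h0 n))
  simp only [intervalIntegral_eq_restrict_Icc hL] at hz ⊢
  obtain ⟨w, σ₂, hwL, hσ₂, hconv, hlsc⟩ :=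
    exists_subseq_tendsto_setIntegral (fun n => (hq (σ₁ n)).memLp) fun n => hz (σ₁ n)
  refine ⟨σ₁ ∘ σ₂, fun y => c + ∫ t in (0 : ℝ)..y, w t, w, hσ₁.comp hσ₂, ⟨hwL, fun y _ => by simp⟩,
    fun y hy => ?_, hlsc⟩
  have hlim := hconv (Icc 0 y) measurableSet_Icc (measure_ne_top _ _)
  simp only [Measure.restrict_restrict measurableSet_Icc,
    inter_eq_self_of_subset_left (Icc_subset_Icc_right hy.2),
    ← intervalIntegral_eq_restrict_Icc hy.1] at hlim
  exact ((hc.comp hσ₂.tendsto_atTop).add hlim).congr fun n => ((hq _).eq_add_integral y hy).symm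

end WeakCompactness

/-! ### The energy density -/

section EnergyDensity

lemma half_mul_sq_le_sub_tangent {s : Set ℝ} (hs : Convex ℝ s) {f f' f'' : ℝ → ℝ} {m x y : ℝ}
    (hf : ∀ t ∈ s, HasDerivWithinAt f (f' t) s t)
    (hf' : ∀ t ∈ s, HasDerivWithinAt f' (f'' t) s t) (hm : ∀ t ∈ s, m ≤ f'' t)
    (hx : x ∈ s) (hy : y ∈ s) : m / 2 * (y - x) ^ 2 ≤ f y - f x - f' x * (y - x) := by
  have hF (t : ℝ) (ht : t ∈ s) :
      HasDerivWithinAt (fun t => f t - m / 2 * t ^ 2) (f' t - m * t) s t := by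
    refine ((hf t ht).sub (((hasDerivWithinAt_id t s).pow 2).const_mul (m / 2))).congr_deriv ?_
    simp only [id_eq]
    ring
  have hF' (t : ℝ) (ht : t ∈ s) : HasDerivWithinAt (fun t => f' t - m * t) (f'' t - m) s t := by
    refine ((hf' t ht).sub ((hasDerivWithinAt_id t s).const_mul m)).congr_deriv ?_
    ring
  have hconv : ConvexOn ℝ s fun t => f t - m / 2 * t ^ 2 :=
    convexOn_of_hasDerivWithinAt2_nonneg hs (fun t ht => (hF t ht).continuousWithinAt)
      (fun t ht => (hF t (interior_subset ht)).mono interior_subset)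
      (fun t ht => (hF' t (interior_subset ht)).mono interior_subset)
      fun t ht => sub_nonneg.2 (hm t (interior_subset ht))
  rcases lt_trichotomy x y with hxy | rfl | hxy
  · have hslope := hconv.le_slope_of_hasDerivWithinAt hx hy hxy (hF x hx)
    rw [slope_def_field, le_div_iff₀ (sub_pos.2 hxy)] at hslope
    linarith
  · simp
  · have hslope := hconv.slope_le_of_hasDerivWithinAt hy hx hxy (hF x hx)
    rw [slope_def_field, div_le_iff₀ (sub_pos.2 hxy)] at hslope
    linarith

variable {W : ℝ → ℝ}

lemma hasDerivWithinAt_Wstar (hW : ContDiffOn ℝ 2 (Wstar W) (Ici 0)) {t : ℝ} (ht : 0 ≤ t) :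
    HasDerivWithinAt (Wstar W) (Sstar W t) (Ici 0) t :=
  (hW.differentiableOn two_ne_zero t ht).hasDerivWithinAt

lemma contDiffOn_Sstar (hW : ContDiffOn ℝ 2 (Wstar W) (Ici 0)) :
    ContDiffOn ℝ 1 (Sstar W) (Ici 0) :=
  hW.derivWithin (uniqueDiffOn_Ici 0) (by norm_num)

lemma hasDerivWithinAt_Sstar (hW : ContDiffOn ℝ 2 (Wstar W) (Ici 0)) {t : ℝ} (ht : 0 ≤ t) :
    HasDerivWithinAt (Sstar W) (Mstar W t) (Ici 0) t :=
  ((contDiffOn_Sstar hW).differentiableOn one_ne_zero t ht).hasDerivWithinAt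

lemma continuousOn_Mstar (hW : ContDiffOn ℝ 2 (Wstar W) (Ici 0)) :
    ContinuousOn (Mstar W) (Ici 0) :=
  (contDiffOn_Sstar hW).continuousOn_derivWithin (uniqueDiffOn_Ici 0) le_rfl

lemma Wstar_zero : Wstar W 0 = 0 := zero_mul _

lemma Wstar_taylor_le (hW : ContDiffOn ℝ 2 (Wstar W) (Ici 0)) {x y m : ℝ} (hx : 0 ≤ x)
    (hy : 0 ≤ y) (hm : ∀ t ∈ uIcc x y, m ≤ Mstar W t) :
    m / 2 * (y - x) ^ 2 ≤ Wstar W y - Wstar W x - Sstar W x * (y - x) :=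
  have hs : uIcc x y ⊆ Ici 0 := fun _ ht => (le_min hx hy).trans ht.1
  half_mul_sq_le_sub_tangent (convex_uIcc x y)
    (fun _ ht => (hasDerivWithinAt_Wstar hW (hs ht)).mono hs)
    (fun _ ht => (hasDerivWithinAt_Sstar hW (hs ht)).mono hs) hm left_mem_uIcc right_mem_uIcc

end EnergyDensity

/-! ### Crack faces -/

section FiniteSets

variable {α : Type*} [LinearOrder α] {S : Set α} {x y : α}

lemma exists_last_lt_of_finite (hS : S.Finite) (hx : x ∈ S) (hxy : x < y) :
    ∃ a ∈ S, a < y ∧ ∀ t ∈ Ioo a y, t ∉ S := by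
  obtain ⟨a, ha, hmax⟩ := exists_max_image (S ∩ Iio y) id (hS.inter_of_left _) ⟨x, hx, hxy⟩
  exact ⟨a, ha.1, ha.2, fun t ht htS => (hmax t ⟨htS, ht.2⟩).not_gt ht.1⟩

lemma exists_first_gt_of_finite (hS : S.Finite) (hy : y ∈ S) (hxy : x < y) :
    ∃ b ∈ S, x < b ∧ ∀ t ∈ Ioo x b, t ∉ S := by
  obtain ⟨b, hb, hmin⟩ := exists_min_image (S ∩ Ioi x) id (hS.inter_of_left _) ⟨y, hy, hxy⟩
  exact ⟨b, hb.1, hb.2, fun t ht htS => (hmin t ⟨htS, ht.1⟩).not_gt ht.2⟩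

end FiniteSets

section Cracks

variable {L : ℝ} {h η : ℝ → ℝ} {a b c d y : ℝ}

lemma isClosed_broken (hL : 0 ≤ L) (hh : MemH2 L h) : IsClosed (broken L h) :=
  (hh.continuousOn_D hL).preimage_isClosed_of_isClosed isClosed_Icc isClosed_singleton

lemma mem_crackFaces_iff : y ∈ crackFaces L h ↔ y ∈ broken L h ∧ broken L h ∉ 𝓝[Icc 0 L] y := by
  simp only [(nhdsWithin_hasBasis Metric.nhds_basis_closedBall _).mem_iff,
    Real.closedBall_eq_Icc]
  rfl

lemma notMem_crackFaces_of_mem_nhds (hy : broken L h ∈ 𝓝 y) : y ∉ crackFaces L h :=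
  fun hyC => (mem_crackFaces_iff.1 hyC).2 (mem_nhdsWithin_of_mem_nhds hy)

lemma NondegenerateCracks.eventually (hnd : NondegenerateCracks L h) (hy : y ∈ crackFaces L h) :
    ((∀ᶠ t in 𝓝[>] y, t ∈ broken L h) ∧ ∀ᶠ t in 𝓝[<] y, t ∈ good L h) ∨
      ((∀ᶠ t in 𝓝[<] y, t ∈ broken L h) ∧ ∀ᶠ t in 𝓝[>] y, t ∈ good L h) := by
  obtain ⟨α, hα, H⟩ := hnd y hy
  have hgt : Ioo y (y + α) ∈ 𝓝[>] y := Ioo_mem_nhdsGT (lt_add_of_pos_right y hα)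
  have hlt : Ioo (y - α) y ∈ 𝓝[<] y := Ioo_mem_nhdsLT (sub_lt_self y hα)
  exact H.imp (fun H => ⟨mem_of_superset hgt (Ioo_subset_Ico_self.trans H.1),
      mem_of_superset hlt H.2⟩)
    fun H => ⟨mem_of_superset hlt (Ioo_subset_Ioc_self.trans H.1), mem_of_superset hgt H.2⟩

lemma crackFaces_subset_Ioo (hnd : NondegenerateCracks L h) : crackFaces L h ⊆ Ioo 0 L := by
  intro y hy
  have hside : (∀ᶠ t in 𝓝[<] y, t ∈ Icc 0 L) ∧ ∀ᶠ t in 𝓝[>] y, t ∈ Icc 0 L := by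
    rcases hnd.eventually hy with ⟨hB, hG⟩ | ⟨hB, hG⟩
    · exact ⟨hG.mono fun t ht => ht.1, hB.mono fun t ht => ht.1⟩
    · exact ⟨hB.mono fun t ht => ht.1, hG.mono fun t ht => ht.1⟩
  obtain ⟨s, hs, hsy⟩ := (hside.1.and self_mem_nhdsWithin).exists
  obtain ⟨t, ht, hty⟩ := (hside.2.and self_mem_nhdsWithin).exists
  exact ⟨hs.1.trans_lt hsy, lt_of_lt_of_le hty ht.2⟩

lemma NondegenerateCracks.eventually_notMem_crackFaces (hnd : NondegenerateCracks L h)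
    (hy : y ∈ crackFaces L h) : ∀ᶠ t in 𝓝[≠] y, t ∉ crackFaces L h := by
  have hgood : ∀ t ∈ good L h, t ∉ crackFaces L h := fun t ht htC => ht.2 htC.1
  have hbroken {s : Set ℝ} (hs : IsOpen s) (hB : ∀ᶠ t in 𝓝[s] y, t ∈ broken L h) :
      ∀ᶠ t in 𝓝[s] y, t ∉ crackFaces L h := by
    filter_upwards [eventually_eventually_nhdsWithin.2 hB, self_mem_nhdsWithin] with t ht hts
    exact notMem_crackFaces_of_mem_nhds ((hs.nhdsWithin_eq hts) ▸ ht)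
  rw [← nhdsLT_sup_nhdsGT, eventually_sup]
  rcases hnd.eventually hy with ⟨hB, hG⟩ | ⟨hB, hG⟩
  · exact ⟨hG.mono hgood, hbroken isOpen_Ioi hB⟩
  · exact ⟨hbroken isOpen_Iio hB, hG.mono hgood⟩

lemma finite_crackFaces (hL : 0 ≤ L) (hh : MemH2 L h) (hnd : NondegenerateCracks L h) :
    (crackFaces L h).Finite := by
  by_contra hinf
  obtain ⟨x, _, hx⟩ := Set.Infinite.exists_accPt_of_subset_isCompact hinf isCompact_Icc
    fun y hy => hy.1.1
  rw [accPt_iff_frequently_nhdsNE] at hx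
  have hxB : x ∈ broken L h := by
    rw [← (isClosed_broken hL hh).closure_eq, mem_closure_iff_frequently]
    exact (hx.filter_mono nhdsWithin_le_nhds).mono fun y hy => hy.1
  have hxC : x ∈ crackFaces L h := by
    refine mem_crackFaces_iff.2 ⟨hxB, fun hB => ?_⟩
    have hev := eventually_nhdsWithin_iff.1 (eventually_eventually_nhdsWithin.2 hB)
    obtain ⟨y, hyC, hy⟩ := (hx.and_eventually (nhdsWithin_le_nhds hev)).exists
    exact (mem_crackFaces_iff.1 hyC).2 (hy hyC.1.1)
  exact hx (hnd.eventually_notMem_crackFaces hxC)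

lemma Ioo_subset_broken_or_good (hL : 0 ≤ L) (hh : MemH2 L h) (hc : 0 ≤ c) (hd : d ≤ L)
    (hcd : ∀ y ∈ Ioo c d, y ∉ crackFaces L h) : Ioo c d ⊆ broken L h ∨ Ioo c d ⊆ good L h := by
  have hsub : Ioo c d ⊆ Ioo 0 L := Ioo_subset_Ioo hc hd
  have hcover : Ioo c d ⊆ interior (broken L h) ∪ (broken L h)ᶜ := by
    intro y hy
    refine or_iff_not_imp_right.2 fun hyB => mem_interior_iff_mem_nhds.2 ?_
    rw [← nhdsWithin_eq_nhds.2 (Icc_mem_nhds (hsub hy).1 (hsub hy).2)]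
    by_contra hB
    exact hcd y hy (mem_crackFaces_iff.2 ⟨not_not.1 hyB, hB⟩)
  refine (isPreconnected_Ioo.subset_or_subset isOpen_interior (isClosed_broken hL hh).isOpen_compl
    (disjoint_compl_right.mono_left interior_subset) hcover).imp (fun H => H.trans interior_subset)
    fun H y hy => ⟨Ioo_subset_Icc_self (hsub hy), H hy⟩

lemma ae_derivWithin_eq_zero_of_eq (f : ℝ → ℝ) (s : Set ℝ) (c : ℝ) :
    ∀ᵐ y, y ∈ s ∧ f y = c → derivWithin f s y = 0 := by
  let t : Set ℝ := {y ∈ s | f y = c}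
  have hisolated : ∀ᵐ y, y ∉ {x ∈ t | 𝓝[t ∩ Ioi x] x = ⊥} :=
    (countable_setOfPred_isolated_right_within (s := t)).ae_notMem volume
  filter_upwards [hisolated] with y hy hyt
  have hacc : AccPt y (𝓟 t) := by
    rw [accPt_principal_iff_nhdsWithin]
    have : (𝓝[t ∩ Ioi y] y).NeBot := neBot_iff.2 fun hbot => hy ⟨hyt, hbot⟩
    exact this.mono (nhdsWithin_mono y fun x hx => ⟨hx.1, (ne_of_lt hx.2).symm⟩)
  by_cases hd : DifferentiableWithinAt ℝ f s y
  · refine (uniqueDiffWithinAt_iff_accPt.2 hacc).eq_deriv _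
      (hd.hasDerivWithinAt.mono fun x hx => hx.1) ?_
    exact (hasDerivWithinAt_const y t c).congr (fun x hx => hx.2) hyt.2
  · exact derivWithin_zero_of_not_differentiableWithinAt hd

lemma ae_D_D_eq_zero (L : ℝ) (h : ℝ → ℝ) : ∀ᵐ y, y ∈ broken L h → D L (D L h) y = 0 :=
  ae_derivWithin_eq_zero_of_eq (D L h) (Icc 0 L) 0

/-- The points at which every admissible variation vanishes: the two ends of the bar and the crack
faces. They cut the bar into the intervals on which the energy is compared. -/
def fixedPoints (L : ℝ) (h : ℝ → ℝ) : Set ℝ := insert 0 (insert L (crackFaces L h))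

lemma zero_mem_fixedPoints (L : ℝ) (h : ℝ → ℝ) : 0 ∈ fixedPoints L h := mem_insert _ _

lemma right_mem_fixedPoints (L : ℝ) (h : ℝ → ℝ) : L ∈ fixedPoints L h :=
  mem_insert_of_mem _ (mem_insert _ _)

lemma crackFaces_subset_fixedPoints (L : ℝ) (h : ℝ → ℝ) : crackFaces L h ⊆ fixedPoints L h :=
  (subset_insert _ _).trans (subset_insert _ _)

lemma finite_fixedPoints (hL : 0 ≤ L) (hh : MemH2 L h) (hnd : NondegenerateCracks L h) :
    (fixedPoints L h).Finite :=
  ((finite_crackFaces hL hh hnd).insert _).insert _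

lemma fixedPoints_subset_Icc (hL : 0 ≤ L) : fixedPoints L h ⊆ Icc 0 L := by
  rintro y (rfl | rfl | hy)
  exacts [left_mem_Icc.2 hL, right_mem_Icc.2 hL, hy.1.1]

lemma eq_zero_of_mem_fixedPoints (hη : η ∈ admissibleVariations L h) (hy : y ∈ fixedPoints L h) :
    η y = 0 := by
  rcases hy with rfl | rfl | hy
  exacts [hη.1.2.1, hη.1.2.2, hη.2.2 y hy]

lemma D_eq_zero_of_Ioo_subset_broken (hL : 0 ≤ L) (hh : MemH2 L h)
    (hη : η ∈ admissibleVariations L h) (hc : c ∈ fixedPoints L h) (hd : d ∈ fixedPoints L h)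
    (hcd : c < d) (hB : Ioo c d ⊆ broken L h) (hy : y ∈ Icc c d) : D L η y = 0 := by
  have hcL := fixedPoints_subset_Icc hL hc
  have hdL := fixedPoints_subset_Icc hL hd
  have hB' : Icc c d ⊆ broken L h :=
    closure_Ioo hcd.ne ▸ closure_minimal hB (isClosed_broken hL hh)
  by_contra hne
  have hpos : 0 < ∫ t in c..d, D L η t := intervalIntegral.integral_pos hcd
    ((hη.1.1.continuousOn_D hL).mono (Icc_subset_Icc hcL.1 hdL.2))
    (fun x hx => hη.2.1 x (hB' (Ioc_subset_Icc_self hx)))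
    ⟨y, hy, (hη.2.1 y (hB' hy)).lt_of_ne (Ne.symm hne)⟩
  rw [← hη.1.1.sub_eq_integral_D hcL hdL, eq_zero_of_mem_fixedPoints hη hc,
    eq_zero_of_mem_fixedPoints hη hd, sub_self] at hpos
  exact lt_irrefl _ hpos

lemma D_eq_zero_of_mem_crackFaces (hL : 0 ≤ L) (hh : MemH2 L h) (hnd : NondegenerateCracks L h)
    (hη : η ∈ admissibleVariations L h) (hy : y ∈ crackFaces L h) : D L η y = 0 := by
  have hyL := crackFaces_subset_Ioo hnd hy
  have hyF := crackFaces_subset_fixedPoints L h hy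
  have hfin := finite_fixedPoints hL hh hnd
  have hsplit {c d : ℝ} (hc : c ∈ fixedPoints L h) (hd : d ∈ fixedPoints L h)
      (hno : ∀ t ∈ Ioo c d, t ∉ fixedPoints L h) :=
    Ioo_subset_broken_or_good hL hh (fixedPoints_subset_Icc hL hc).1
      (fixedPoints_subset_Icc hL hd).2
      fun t ht htC => hno t ht (crackFaces_subset_fixedPoints L h htC)
  rcases hnd.eventually hy with ⟨hB, -⟩ | ⟨hB, -⟩
  · obtain ⟨x, hx, hyx, hno⟩ :=
      exists_first_gt_of_finite hfin (right_mem_fixedPoints L h) hyL.2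
    refine D_eq_zero_of_Ioo_subset_broken hL hh hη hyF hx hyx
      ((hsplit hyF hx hno).resolve_right fun hG => ?_) (left_mem_Icc.2 hyx.le)
    obtain ⟨t, htB, ht⟩ := (hB.and (Ioo_mem_nhdsGT hyx)).exists
    exact (hG ht).2 htB
  · obtain ⟨x, hx, hxy, hno⟩ :=
      exists_last_lt_of_finite hfin (zero_mem_fixedPoints L h) hyL.1
    refine D_eq_zero_of_Ioo_subset_broken hL hh hη hx hyF hxy
      ((hsplit hx hyF hno).resolve_right fun hG => ?_) (right_mem_Icc.2 hxy.le)
    obtain ⟨t, htB, ht⟩ := (hB.and (Ioo_mem_nhdsLT hxy)).exists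
    exact (hG ht).2 htB

/-- An unbroken interval each of whose end points is an end of the bar or a crack face. -/
structure IsUnbrokenSpan (L : ℝ) (h : ℝ → ℝ) (a b : ℝ) : Prop where
  left_mem : a ∈ fixedPoints L h
  right_mem : b ∈ fixedPoints L h
  lt : a < b
  subset_good : Ioo a b ⊆ good L h

namespace IsUnbrokenSpan

lemma Icc_subset (hL : 0 ≤ L) (hab : IsUnbrokenSpan L h a b) : Icc a b ⊆ Icc 0 L :=
  Icc_subset_Icc (fixedPoints_subset_Icc hL hab.left_mem).1
    (fixedPoints_subset_Icc hL hab.right_mem).2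

lemma left_eq_zero_or_mem (hL : 0 ≤ L) (hab : IsUnbrokenSpan L h a b) :
    a = 0 ∨ a ∈ crackFaces L h :=
  hab.left_mem.imp_right fun ha => ha.resolve_left
    (hab.lt.trans_le (fixedPoints_subset_Icc hL hab.right_mem).2).ne

lemma right_eq_or_mem (hL : 0 ≤ L) (hab : IsUnbrokenSpan L h a b) :
    b = L ∨ b ∈ crackFaces L h :=
  hab.right_mem.resolve_left ((fixedPoints_subset_Icc hL hab.left_mem).1.trans_lt hab.lt).ne'

lemma left_mem_crackFaces (hab : IsUnbrokenSpan L h a b) (ha : a ∈ broken L h) :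
    a ∈ crackFaces L h := by
  refine mem_crackFaces_iff.2 ⟨ha, fun hB => ?_⟩
  obtain ⟨t, ht, htab⟩ := ((eventually_nhdsWithin_iff.1 hB).filter_mono
    (nhdsWithin_le_nhds (s := Ioi a)) |>.and (Ioo_mem_nhdsGT hab.lt)).exists
  exact (hab.subset_good htab).2 (ht (hab.subset_good htab).1)

lemma right_mem_crackFaces (hab : IsUnbrokenSpan L h a b) (hb : b ∈ broken L h) :
    b ∈ crackFaces L h := by
  refine mem_crackFaces_iff.2 ⟨hb, fun hB => ?_⟩
  obtain ⟨t, ht, htab⟩ := ((eventually_nhdsWithin_iff.1 hB).filter_mono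
    (nhdsWithin_le_nhds (s := Iio b)) |>.and (Ioo_mem_nhdsLT hab.lt)).exists
  exact (hab.subset_good htab).2 (ht (hab.subset_good htab).1)

lemma eq_of_not_disjoint (hab : IsUnbrokenSpan L h a b) (hL : 0 ≤ L) (hcd : IsUnbrokenSpan L h c d)
    (hy : y ∈ Ioo a b) (hy' : y ∈ Ioo c d) : a = c ∧ b = d := by
  have key {a b c d : ℝ} (hab : IsUnbrokenSpan L h a b) (hcd : IsUnbrokenSpan L h c d)
      (hy : y ∈ Ioo a b) (hy' : y ∈ Ioo c d) : a ≤ c ∧ d ≤ b := by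
    constructor
    · by_contra! hca
      rcases hab.left_eq_zero_or_mem hL with ha | ha
      · linarith [(fixedPoints_subset_Icc hL hcd.left_mem).1]
      · exact (hcd.subset_good ⟨hca, hy.1.trans hy'.2⟩).2 ha.1
    · by_contra! hbd
      rcases hab.right_eq_or_mem hL with hb | hb
      · linarith [(fixedPoints_subset_Icc hL hcd.right_mem).2]
      · exact (hcd.subset_good ⟨hy'.1.trans hy.2, hbd⟩).2 hb.1
  exact ⟨le_antisymm (key hab hcd hy hy').1 (key hcd hab hy' hy).1,
    le_antisymm (key hcd hab hy' hy).2 (key hab hcd hy hy').2⟩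

end IsUnbrokenSpan

namespace IsUnbrokenPart

lemma isUnbrokenSpan (hab : IsUnbrokenPart L h a b) : IsUnbrokenSpan L h a b where
  left_mem := crackFaces_subset_fixedPoints L h hab.1
  right_mem := crackFaces_subset_fixedPoints L h hab.2.1
  lt := hab.2.2.1
  subset_good := hab.2.2.2

lemma eventually_broken_left (hnd : NondegenerateCracks L h) (hab : IsUnbrokenPart L h a b) :
    ∀ᶠ t in 𝓝[<] a, t ∈ broken L h := by
  obtain ⟨ha, -, hlt, hG⟩ := hab
  refine (hnd.eventually ha).elim (fun H => ?_) And.left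
  obtain ⟨t, htB, ht⟩ := (H.1.and (Ioo_mem_nhdsGT hlt)).exists
  exact absurd htB (hG ht).2

lemma eventually_broken_right (hnd : NondegenerateCracks L h) (hab : IsUnbrokenPart L h a b) :
    ∀ᶠ t in 𝓝[>] b, t ∈ broken L h := by
  obtain ⟨-, hb, hlt, hG⟩ := hab
  refine (hnd.eventually hb).elim And.left fun H => ?_
  obtain ⟨t, htB, ht⟩ := (H.1.and (Ioo_mem_nhdsLT hlt)).exists
  exact absurd htB (hG ht).2

lemma exists_margin (hnd : NondegenerateCracks L h) (hab : IsUnbrokenPart L h a b) :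
    ∃ ρ > 0, Icc (a - ρ) a ⊆ broken L h ∧ Icc b (b + ρ) ⊆ broken L h := by
  obtain ⟨c, hc, hBc⟩ := mem_nhdsLT_iff_exists_Ico_subset.1 (hab.eventually_broken_left hnd)
  obtain ⟨d, hd, hBd⟩ := mem_nhdsGT_iff_exists_Ioc_subset.1 (hab.eventually_broken_right hnd)
  refine ⟨min (a - c) (d - b), lt_min (sub_pos.2 hc) (sub_pos.2 hd), fun t ht => ?_, fun t ht => ?_⟩
  · rcases ht.2.eq_or_lt with rfl | hta
    · exact hab.1.1
    · exact hBc ⟨by linarith [ht.1, min_le_left (a - c) (d - b)], hta⟩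
  · rcases ht.1.eq_or_lt with rfl | hbt
    · exact hab.2.1.1
    · exact hBd ⟨hbt, by linarith [ht.2, min_le_right (a - c) (d - b)]⟩

end IsUnbrokenPart

end Cracks

/-! ### Truncation and translation -/

section truncation

variable {L a b c d τ y : ℝ} {f F p w : ℝ → ℝ}

lemma integral_indicator_Icc_eq_clamp (hab : a ≤ b) (f : ℝ → ℝ) (x y : ℝ) :
    ∫ t in x..y, (Icc a b).indicator f t = ∫ t in max a (min b x)..max a (min b y), f t := by
  wlog hxy : x ≤ y generalizing x y
  · rw [intervalIntegral.integral_symm, this y x (le_of_not_ge hxy),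
      ← intervalIntegral.integral_symm]
  have hclamp : max a (min b x) ≤ max a (min b y) := by gcongr
  have hinter : Ioc x y ∩ Ioc a b = Ioc (max a (min b x)) (max a (min b y)) := by
    ext t
    simp only [mem_inter_iff, mem_Ioc]
    grind
  have hset : (Ioc x y ∩ Icc a b : Set ℝ) =ᵐ[volume] Ioc (max a (min b x)) (max a (min b y)) :=
    hinter ▸ ae_eq_set_inter ae_eq_rfl Ioc_ae_eq_Icc.symm
  rw [intervalIntegral.integral_of_le hxy, intervalIntegral.integral_of_le hclamp,
    setIntegral_indicator measurableSet_Icc, setIntegral_congr_set hset]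

lemma indicator_Icc_eq_clamp (hab : a ≤ b) (ha : y < a → p a = 0) (hb : b < y → p b = 0) :
    (Icc a b).indicator p y = p (max a (min b y)) := by
  rcases lt_or_ge y a with hya | hya
  · rw [indicator_of_notMem fun h => hya.not_ge h.1, min_eq_right (hya.le.trans hab),
      max_eq_left hya.le, ha hya]
  rcases le_or_gt y b with hyb | hyb
  · rw [indicator_of_mem (mem_Icc.2 ⟨hya, hyb⟩), min_eq_right hyb, max_eq_right hya]
  · rw [indicator_of_notMem fun h => hyb.not_ge h.2, min_eq_left hyb.le, max_eq_right hab, hb hyb]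

lemma integral_indicator_Icc (hc : c ≤ a) (hab : a ≤ b) (hd : b ≤ d) (f : ℝ → ℝ) :
    ∫ t in c..d, (Icc a b).indicator f t = ∫ t in a..b, f t := by
  rw [integral_indicator_Icc_eq_clamp hab, min_eq_right (hc.trans hab), max_eq_left hc,
    min_eq_left hd, max_eq_right hab]

lemma integral_indicator_Icc_translate (hab : a ≤ b) (ha : τ ≤ a) (hb : b ≤ L + τ) (f : ℝ → ℝ) :
    ∫ y in (0 : ℝ)..L, (Icc a b).indicator f (y + τ) = ∫ y in a..b, f y := by
  rw [intervalIntegral.integral_comp_add_right ((Icc a b).indicator f), zero_add,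
    integral_indicator_Icc ha hab hb]

lemma memLp_indicator_Icc (hw : MemLp w 2 (volume.restrict (Icc 0 L))) (ha : 0 ≤ a) (hb : b ≤ L) :
    MemLp ((Icc a b).indicator w) 2 volume := by
  rw [memLp_indicator_iff_restrict measurableSet_Icc]
  exact hw.mono_measure (Measure.restrict_mono (Icc_subset_Icc ha hb) le_rfl)

lemma intervalIntegrable_of_memLp (hf : MemLp f 2 volume) (c d : ℝ) :
    IntervalIntegrable f volume c d :=
  intervalIntegrable_of_memLp_Icc (hf.restrict _) left_mem_uIcc right_mem_uIcc

lemma memH1_translate (hf : MemLp f 2 volume) (hF : ∀ x y, F y - F x = ∫ t in x..y, f t) (τ : ℝ) :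
    MemH1 L (fun y => F (y + τ)) (fun y => f (y + τ)) := by
  refine ⟨(hf.comp_measurePreserving (measurePreserving_add_right volume τ)).restrict _,
    fun y _ => ?_⟩
  rw [intervalIntegral.integral_comp_add_right f, ← hF, add_sub_cancel]

namespace MemH1

lemma indicator (hp : MemH1 L p w) (ha : 0 ≤ a) (hab : a ≤ b) (hb : b ≤ L)
    (hpa : a = 0 ∨ p a = 0) (hpb : b = L ∨ p b = 0) :
    MemH1 L ((Icc a b).indicator p) ((Icc a b).indicator w) := by
  have hclamp : ∀ y ∈ Icc 0 L, (Icc a b).indicator p y = p (max a (min b y)) := fun y hy =>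
    indicator_Icc_eq_clamp hab (fun hya => hpa.resolve_left (hy.1.trans_lt hya).ne')
      fun hyb => hpb.resolve_left (hyb.trans_le hy.2).ne
  have hmem (y : ℝ) : max a (min b y) ∈ Icc 0 L :=
    ⟨ha.trans (le_max_left _ _), (max_le hab (min_le_left _ _)).trans hb⟩
  refine ⟨hp.memLp.indicator measurableSet_Icc, fun y hy => ?_⟩
  rw [hclamp y hy, hclamp 0 ⟨le_rfl, hy.1.trans hy.2⟩, integral_indicator_Icc_eq_clamp hab,
    ← hp.sub_eq_integral (hmem 0) (hmem y), add_sub_cancel]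

lemma indicator_sub_eq_integral (hp : MemH1 L p w) (ha : 0 ≤ a) (hab : a ≤ b) (hb : b ≤ L)
    (hpa : p a = 0) (hpb : p b = 0) (x y : ℝ) :
    (Icc a b).indicator p y - (Icc a b).indicator p x = ∫ t in x..y, (Icc a b).indicator w t := by
  have hmem (y : ℝ) : max a (min b y) ∈ Icc 0 L :=
    ⟨ha.trans (le_max_left _ _), (max_le hab (min_le_left _ _)).trans hb⟩
  rw [integral_indicator_Icc_eq_clamp hab, ← hp.sub_eq_integral (hmem x) (hmem y),
    indicator_Icc_eq_clamp hab (fun _ => hpa) fun _ => hpb,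
    indicator_Icc_eq_clamp hab (fun _ => hpa) fun _ => hpb]

lemma indicator_translate (hp : MemH1 L p w) (ha : 0 ≤ a) (hab : a ≤ b) (hb : b ≤ L)
    (hpa : p a = 0) (hpb : p b = 0) (τ : ℝ) :
    MemH1 L (fun y => (Icc a b).indicator p (y + τ))
      (fun y => (Icc a b).indicator w (y + τ)) :=
  memH1_translate (memLp_indicator_Icc hp.memLp ha hb)
    (hp.indicator_sub_eq_integral ha hab hb hpa hpb) τ

end MemH1

lemma continuous_of_sub_eq_integral (hf : ∀ x y, IntervalIntegrable f volume x y)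
    (hF : ∀ x y, F y - F x = ∫ t in x..y, f t) : Continuous F := by
  have hFeq : F = fun y => F 0 + ∫ t in (0 : ℝ)..y, f t := by
    funext y
    rw [← hF, add_sub_cancel]
  rw [hFeq]
  exact continuous_const.add (intervalIntegral.continuous_primitive hf 0)

lemma integral_sq_translate_sub_le (hL : 0 ≤ L) (hf : MemLp f 2 volume)
    (hF : ∀ x y, F y - F x = ∫ t in x..y, f t) (hτ : 0 ≤ τ) :
    ∫ y in (0 : ℝ)..L, (F (y + τ) - F y) ^ 2 ≤ τ ^ 2 * ∫ t, f t ^ 2 := by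
  have hi := intervalIntegrable_of_memLp hf
  have hi2 (x y : ℝ) : IntervalIntegrable (fun t => f t ^ 2) volume x y :=
    hf.integrable_sq.intervalIntegrable
  set B : ℝ → ℝ := fun y => ∫ t in (0 : ℝ)..y, f t ^ 2
  have hB (x y : ℝ) : B y - B x = ∫ t in x..y, f t ^ 2 :=
    intervalIntegral.integral_interval_sub_left (hi2 _ _) (hi2 _ _)
  have hBmono : Monotone B := fun x y hxy => by
    rw [← sub_nonneg, hB]
    exact intervalIntegral.integral_nonneg hxy fun _ _ => sq_nonneg _
  have hBcont : Continuous B := intervalIntegral.continuous_primitive hi2 0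
  have hFcont := continuous_of_sub_eq_integral hi hF
  have hslope (y : ℝ) : τ ^ 2 * slope B y (y + τ) = τ * (B (y + τ) - B y) := by
    rcases eq_or_ne τ 0 with rfl | hτ0
    · simp
    · rw [slope_def_field, add_sub_cancel_left]
      field_simp
  calc ∫ y in (0 : ℝ)..L, (F (y + τ) - F y) ^ 2
      ≤ ∫ y in (0 : ℝ)..L, τ ^ 2 * slope B y (y + τ) := by
        simp_rw [hslope]
        refine intervalIntegral.integral_mono_on hL
          (Continuous.intervalIntegrable (by fun_prop) _ _)
          (Continuous.intervalIntegrable (by fun_prop) _ _) fun y _ => ?_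
        rw [hF, hB]
        simpa using sq_integral_le_mul_integral_sq (le_add_of_nonneg_right hτ : y ≤ y + τ)
          (hi _ _) (hi2 _ _)
    _ ≤ τ ^ 2 * (B (L + τ) - B 0) := by
        rw [intervalIntegral.integral_const_mul]
        exact mul_le_mul_of_nonneg_left
          ((hBmono.monotoneOn _).intervalIntegral_slope_le hL hτ) (sq_nonneg τ)
    _ ≤ τ ^ 2 * ∫ t, f t ^ 2 := by
        refine mul_le_mul_of_nonneg_left ?_ (sq_nonneg τ)
        rw [hB, intervalIntegral.integral_of_le (by positivity)]
        exact setIntegral_le_integral hf.integrable_sq (Eventually.of_forall fun _ => sq_nonneg _)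

end truncation

/-! ### Comparison of energies on an unbroken span -/

/-- The integrand of the energy, as a function of the slope `q = h'` and its derivative
`z = h''`. -/
def density (W : ℝ → ℝ) (ε : ℝ) (q z : ℝ → ℝ) (y : ℝ) : ℝ := ε ^ 2 / 2 * z y ^ 2 + Wstar W (q y)

/-- The slope `h'` on `[a,b]`, extended by zero. -/
def truncD (L : ℝ) (h : ℝ → ℝ) (a b : ℝ) : ℝ → ℝ := (Icc a b).indicator (D L h)

/-- The second derivative `h''` on `[a,b]`, extended by zero. -/
def truncDD (L : ℝ) (h : ℝ → ℝ) (a b : ℝ) : ℝ → ℝ := (Icc a b).indicator (D L (D L h))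

/-- The quadratic form `∫₀ᴸ ε² (φ')² + m φ²` in `φ ∈ H¹(0,L)` with derivative `u = φ'`; for
`m = M*(h')` and `φ = η'` it is the second variation. -/
def quadForm (ε L : ℝ) (m φ u : ℝ → ℝ) : ℝ :=
  ∫ y in (0 : ℝ)..L, (ε ^ 2 * u y ^ 2 + m y * φ y ^ 2)

/-- The slope `q`, with derivative `z`, competes with `h'` on `[a,b]`: it accounts for the same
total displacement and lives on `[a,b]` and the broken set only. -/
structure IsComparison (L : ℝ) (h : ℝ → ℝ) (a b : ℝ) (q z : ℝ → ℝ) : Prop where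
  memH1 : MemH1 L q z
  nonneg : ∀ y ∈ Icc 0 L, 0 ≤ q y
  integral_eq : ∫ y in (0 : ℝ)..L, q y = ∫ y in a..b, D L h y
  eq_zero_or_broken : ∀ y ∈ Icc 0 L, y ∉ Icc a b → y ∈ broken L h ∨ (q y = 0 ∧ z y = 0)

section Comparison

variable {W : ℝ → ℝ} {ε L : ℝ} {h g : ℝ → ℝ} {a b y ρ τ : ℝ} {q z m φ u : ℝ → ℝ}

lemma density_truncD (W : ℝ → ℝ) (ε L : ℝ) (h : ℝ → ℝ) (a b : ℝ) :
    density W ε (truncD L h a b) (truncDD L h a b) =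
      (Icc a b).indicator (density W ε (D L h) (D L (D L h))) := by
  funext y
  by_cases hy : y ∈ Icc a b
  · simp only [density, truncD, truncDD, indicator_of_mem hy]
  · simp [density, truncD, truncDD, indicator_of_notMem hy, Wstar_zero]

lemma truncD_nonneg (hab : Icc a b ⊆ Icc 0 L) (hg : ∀ y ∈ Icc 0 L, 0 ≤ D L g y) (y : ℝ) :
    0 ≤ truncD L g a b y :=
  indicator_nonneg (fun t ht => hg t (hab ht)) y

lemma truncD_eq_zero_of_mem_broken (hy : y ∈ broken L h) : truncD L h a b y = 0 :=
  indicator_apply_eq_zero.2 fun _ => hy.2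

lemma IsUnbrokenSpan.memH1_truncD (hab : IsUnbrokenSpan L h a b) (hL : 0 ≤ L) (hg : MemH2 L g)
    (hg0 : ∀ y ∈ crackFaces L h, D L g y = 0) : MemH1 L (truncD L g a b) (truncDD L g a b) :=
  hg.memH1_D.indicator (fixedPoints_subset_Icc hL hab.left_mem).1 hab.lt.le
    (fixedPoints_subset_Icc hL hab.right_mem).2 ((hab.left_eq_zero_or_mem hL).imp_right (hg0 a))
    ((hab.right_eq_or_mem hL).imp_right (hg0 b))

lemma IsUnbrokenSpan.memH1_truncD_self (hab : IsUnbrokenSpan L h a b) (hL : 0 ≤ L)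
    (hh : MemH2 L h) : MemH1 L (truncD L h a b) (truncDD L h a b) :=
  hab.memH1_truncD hL hh fun _ hy => hy.1.2

lemma IsUnbrokenSpan.integral_density_truncD (hab : IsUnbrokenSpan L h a b) (hL : 0 ≤ L) (W : ℝ → ℝ)
    (ε : ℝ) (g : ℝ → ℝ) : ∫ y in (0 : ℝ)..L, density W ε (truncD L g a b) (truncDD L g a b) y =
      ∫ y in a..b, density W ε (D L g) (D L (D L g)) y := by
  rw [density_truncD, integral_indicator_Icc (fixedPoints_subset_Icc hL hab.left_mem).1 hab.lt.le
    (fixedPoints_subset_Icc hL hab.right_mem).2]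

lemma MemH1.intervalIntegrable_density (hq : MemH1 L q z) (hL : 0 ≤ L)
    (hW : ContDiffOn ℝ 2 (Wstar W) (Ici 0)) (hq0 : ∀ y ∈ Icc 0 L, 0 ≤ q y) :
    IntervalIntegrable (density W ε q z) volume 0 L :=
  ((hq.intervalIntegrable_deriv_sq (left_mem_Icc.2 hL) (right_mem_Icc.2 hL)).const_mul _).add
    ((hW.continuousOn.comp (hq.continuousOn hL) hq0).intervalIntegrable_of_Icc hL)

lemma MemH1.quadForm_eq_add (hφ : MemH1 L φ u) (hL : 0 ≤ L) (hm : ContinuousOn m (Icc 0 L)) :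
    quadForm ε L m φ u =
      ε ^ 2 * (∫ y in (0 : ℝ)..L, u y ^ 2) + ∫ y in (0 : ℝ)..L, m y * φ y ^ 2 := by
  have hmφ : IntervalIntegrable (fun y => m y * φ y ^ 2) volume 0 L :=
    (hm.mul ((hφ.continuousOn hL).pow 2)).intervalIntegrable_of_Icc hL
  rw [quadForm, intervalIntegral.integral_add
    ((hφ.intervalIntegrable_deriv_sq (left_mem_Icc.2 hL) (right_mem_Icc.2 hL)).const_mul _) hmφ,
    intervalIntegral.integral_const_mul]

lemma IsComparison.integral_sub_eq_zero (hq : IsComparison L h a b q z) (hL : 0 ≤ L)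
    (hh : MemH2 L h) (hab : IsUnbrokenSpan L h a b) :
    ∫ y in (0 : ℝ)..L, (q y - truncD L h a b y) = 0 := by
  rw [intervalIntegral.integral_sub ((hq.memH1.continuousOn hL).intervalIntegrable_of_Icc hL)
    (((hab.memH1_truncD_self hL hh).continuousOn hL).intervalIntegrable_of_Icc hL), hq.integral_eq,
    truncD, integral_indicator_Icc (fixedPoints_subset_Icc hL hab.left_mem).1 hab.lt.le
    (fixedPoints_subset_Icc hL hab.right_mem).2, sub_self]

/-- The Euler-Lagrange equation is tested with the primitive of `q - h'`, whose slope is nonnegative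
on the broken set. -/
lemma IsComparison.firstVariation_nonneg (hq : IsComparison L h a b q z) (hL : 0 < L)
    (hh : MemH2 L h) (hEL : SolvesEL W ε L h) (hab : IsUnbrokenSpan L h a b) :
    0 ≤ ∫ y in (0 : ℝ)..L, (ε ^ 2 * truncDD L h a b y * (z y - truncDD L h a b y) +
      Sstar W (truncD L h a b y) * (q y - truncD L h a b y)) := by
  obtain ⟨μ, -, -, hμ⟩ := hEL
  have hφ := hq.memH1.sub (hab.memH1_truncD_self hL.le hh)
  set ψ : ℝ → ℝ := fun x => ∫ t in (0 : ℝ)..x, (q t - truncD L h a b t)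
  have hDψ : EqOn (D L ψ) (fun y => q y - truncD L h a b y) (Icc 0 L) :=
    D_primitive hL (hφ.continuousOn hL.le)
  have hψ : ψ ∈ H2H10 L := ⟨hφ.memH2_of_eqOn_primitive hL (eqOn_refl _ _),
    intervalIntegral.integral_same, hq.integral_sub_eq_zero hL.le hh hab⟩
  have hμ_nonneg : 0 ≤ ∫ y in broken L h, D L ψ y ∂μ := by
    refine setIntegral_nonneg (isClosed_broken hL.le hh).measurableSet fun y hy => ?_
    rw [hDψ hy.1]
    simpa only [truncD_eq_zero_of_mem_broken hy, sub_zero] using hq.nonneg y hy.1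
  rw [← hμ ψ hψ] at hμ_nonneg
  refine hμ_nonneg.trans_eq ?_
  rw [intervalIntegral_eq_restrict_Icc hL.le, intervalIntegral_eq_restrict_Icc hL.le]
  refine integral_congr_ae ?_
  filter_upwards [ae_restrict_of_ae (ae_D_D_eq_zero L h), hφ.D_D_primitive hL,
    ae_restrict_mem measurableSet_Icc] with y hyB hyD hy
  rw [hyD, hDψ hy]
  by_cases hyab : y ∈ Icc a b
  · simp only [truncD, truncDD, indicator_of_mem hyab]
  · simp only [truncD, truncDD, indicator_of_notMem hyab]
    rcases hq.eq_zero_or_broken y hy hyab with hyb | ⟨hq0, hz0⟩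
    · rw [hyB hyb, hyb.2]
    · rw [hq0, hz0]
      ring

theorem IsComparison.integral_density_add_quadForm_le (hq : IsComparison L h a b q z) (hL : 0 < L)
    (hW : ContDiffOn ℝ 2 (Wstar W) (Ici 0)) (hK : h ∈ K L) (hEL : SolvesEL W ε L h)
    (hab : IsUnbrokenSpan L h a b) (hm : ContinuousOn m (Icc 0 L))
    (hmM : ∀ y ∈ Icc 0 L, ∀ t ∈ uIcc (truncD L h a b y) (q y), m y ≤ Mstar W t) :
    (∫ y in a..b, density W ε (D L h) (D L (D L h)) y) +
        1 / 2 * quadForm ε L m (fun y => q y - truncD L h a b y) (fun y => z y - truncDD L h a b y)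
      ≤ ∫ y in (0 : ℝ)..L, density W ε q z y := by
  have hP := hab.memH1_truncD_self hL.le hK.1
  have hP0 := truncD_nonneg (hab.Icc_subset hL.le) hK.2.2.2
  have hφ := hq.memH1.sub hP
  have hφc := hφ.continuousOn hL.le
  have h0 : (0 : ℝ) ∈ Icc 0 L := left_mem_Icc.2 hL.le
  have hL' : L ∈ Icc 0 L := right_mem_Icc.2 hL.le
  have hdensity := hP.intervalIntegrable_density (ε := ε) hL.le hW fun y _ => hP0 y
  have hfirst : IntervalIntegrable (fun y => ε ^ 2 * truncDD L h a b y *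
      (z y - truncDD L h a b y) + Sstar W (truncD L h a b y) * (q y - truncD L h a b y))
      volume 0 L := by
    simp_rw [mul_assoc]
    exact ((intervalIntegrable_mul_of_memLp_Icc hL.le hP.memLp hφ.memLp).const_mul _).add
      ((((contDiffOn_Sstar hW).continuousOn.comp (hP.continuousOn hL.le)
        fun y _ => hP0 y).mul hφc).intervalIntegrable_of_Icc hL.le)
  have hsecond : IntervalIntegrable (fun y => ε ^ 2 * (z y - truncDD L h a b y) ^ 2 +
      m y * (q y - truncD L h a b y) ^ 2) volume 0 L :=
    ((hφ.intervalIntegrable_deriv_sq h0 hL').const_mul _).add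
      ((hm.mul (hφc.pow 2)).intervalIntegrable_of_Icc hL.le)
  have hle := intervalIntegral.integral_mono_on hL.le
    ((hdensity.add hfirst).add (hsecond.const_mul (1 / 2)))
    (hq.memH1.intervalIntegrable_density (ε := ε) hL.le hW hq.nonneg) fun y hy => ?_
  · rw [intervalIntegral.integral_add (hdensity.add hfirst) (hsecond.const_mul (1 / 2)),
      intervalIntegral.integral_add hdensity hfirst, intervalIntegral.integral_const_mul,
      hab.integral_density_truncD hL.le] at hle
    have hEL_nonneg := hq.firstVariation_nonneg hL hK.1 hEL hab
    rw [quadForm]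
    linarith
  · have htaylor := Wstar_taylor_le hW (hP0 y) (hq.nonneg y hy) (hmM y hy)
    simp only [density]
    linarith

section translate

variable (hab : a ≤ b) (hBa : Icc (a - ρ) a ⊆ broken L h) (hBb : Icc b (b + ρ) ⊆ broken L h)
  (hτ : |τ| ≤ ρ)
include hab hBa hBb hτ

lemma isComparison_translate (hg : MemH2 L g) (hg' : ∀ y ∈ Icc 0 L, 0 ≤ D L g y)
    (hga : D L g a = 0) (hgb : D L g b = 0) (hint : ∫ y in a..b, D L g y = ∫ y in a..b, D L h y) :
    IsComparison L h a b (fun y => truncD L g a b (y + τ)) (fun y => truncDD L g a b (y + τ)) := by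
  have hρ : 0 ≤ ρ := (abs_nonneg τ).trans hτ
  obtain ⟨hτ1, hτ2⟩ := abs_le.1 hτ
  have ha : 0 ≤ a - ρ := (hBa ⟨le_rfl, by linarith⟩).1.1
  have hb : b + ρ ≤ L := (hBb ⟨by linarith, le_rfl⟩).1.2
  refine ⟨hg.memH1_D.indicator_translate (by linarith) hab (by linarith) hga hgb τ,
    fun y _ => truncD_nonneg (Icc_subset_Icc (by linarith) (by linarith)) hg' _, ?_,
    fun y _ hy => ?_⟩
  · rw [← hint]
    exact integral_indicator_Icc_translate hab (by linarith) (by linarith) _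
  · by_cases hm : y + τ ∈ Icc a b
    · left
      rcases lt_or_ge y a with hya | hya
      · exact hBa ⟨by linarith [hm.1], hya.le⟩
      · exact hBb ⟨le_of_not_ge fun hyb => hy ⟨hya, hyb⟩, by linarith [hm.2]⟩
    · exact Or.inr ⟨indicator_of_notMem hm _, indicator_of_notMem hm _⟩

lemma integral_density_translate (W : ℝ → ℝ) (ε : ℝ) (g : ℝ → ℝ) :
    ∫ y in (0 : ℝ)..L, density W ε (fun y => truncD L g a b (y + τ))
        (fun y => truncDD L g a b (y + τ)) y =
      ∫ y in a..b, density W ε (D L g) (D L (D L g)) y := by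
  have hρ : 0 ≤ ρ := (abs_nonneg τ).trans hτ
  obtain ⟨hτ1, hτ2⟩ := abs_le.1 hτ
  have ha : 0 ≤ a - ρ := (hBa ⟨le_rfl, by linarith⟩).1.1
  have hb : b + ρ ≤ L := (hBb ⟨by linarith, le_rfl⟩).1.2
  rw [← integral_indicator_Icc_translate (L := L) (τ := τ) hab (by linarith) (by linarith),
    ← density_truncD]
  rfl

end translate

end Comparison

/-! ### Regularity of the translation modes -/

section Regularity

variable {W : ℝ → ℝ} {ε L : ℝ} {h g : ℝ → ℝ} {a b y C R ρ : ℝ} {w P : ℝ → ℝ} {τ : ℕ → ℝ}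

lemma exists_bound_D (hL : 0 ≤ L) (hg : MemH2 L g) : ∃ R, 0 ≤ R ∧ ∀ y ∈ Icc 0 L, D L g y ≤ R := by
  obtain ⟨R, hR⟩ := isCompact_Icc.exists_bound_of_continuousOn (hg.continuousOn_D hL)
  exact ⟨R, (norm_nonneg _).trans (hR 0 (left_mem_Icc.2 hL)),
    fun y hy => (le_abs_self _).trans (hR y hy)⟩

lemma exists_bound_Mstar (hW : ContDiffOn ℝ 2 (Wstar W) (Ici 0)) (hR : 0 ≤ R) :
    ∃ C, 0 ≤ C ∧ ∀ t ∈ Icc 0 R, |Mstar W t| ≤ C := by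
  obtain ⟨C, hC⟩ := isCompact_Icc.exists_bound_of_continuousOn
    ((continuousOn_Mstar hW).mono Icc_subset_Ici_self)
  exact ⟨C, (norm_nonneg _).trans (hC 0 (left_mem_Icc.2 hR)), hC⟩

lemma truncD_mem_Icc (hab : Icc a b ⊆ Icc 0 L) (hg : ∀ y ∈ Icc 0 L, 0 ≤ D L g y)
    (hR : 0 ≤ R) (hgR : ∀ y ∈ Icc 0 L, D L g y ≤ R) (y : ℝ) : truncD L g a b y ∈ Icc 0 R :=
  ⟨truncD_nonneg hab hg y, indicator_apply_le' (fun hy => hgR y (hab hy)) fun _ => hR⟩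

lemma exists_memH1_of_differenceQuotient (hL : 0 ≤ L) (hw : MemLp w 2 volume)
    (hP : ∀ x y, P y - P x = ∫ t in x..y, w t) (hτ : Tendsto τ atTop (𝓝[≠] 0))
    (h0 : ∀ n, |(τ n)⁻¹ * (P (0 + τ n) - P 0)| ≤ C)
    (hC : ∀ n, ∫ y in (0 : ℝ)..L, ((τ n)⁻¹ * (w (y + τ n) - w y)) ^ 2 ≤ C) :
    ∃ v u, MemH1 L v u ∧ ∀ y ∈ Icc 0 L, P y - P 0 = ∫ t in (0 : ℝ)..y, v t := by
  have hP' : MemH1 L P w := by simpa only [add_zero] using memH1_translate hw hP 0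
  obtain ⟨σ, v, u, hσ, hv, hlim, -⟩ := exists_subseq_memH1 hL
    (fun n => ((memH1_translate hw hP (τ n)).sub hP').const_mul (τ n)⁻¹) h0 hC
  refine ⟨v, u, hv, fun y hy => ?_⟩
  have hwv : ∀ᵐ t, t ∈ Icc 0 L → w t = v t := by
    filter_upwards [(intervalIntegrable_of_memLp hw 0 L).ae_hasDerivAt_integral] with t hd ht
    have hd' := hd (by rwa [uIcc_of_le hL]) 0 left_mem_uIcc
    simp only [← hP] at hd'
    refine tendsto_nhds_unique (hd'.tendsto_slope_zero.comp (hτ.comp hσ.tendsto_atTop))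
      ((hlim t ht).congr fun n => ?_)
    simp
  rw [hP]
  refine intervalIntegral.integral_congr_ae ?_
  filter_upwards [hwv] with t ht ht'
  rw [uIoc_of_le hy.1] at ht'
  exact ht ⟨ht'.1.le, ht'.2.trans hy.2⟩

namespace IsUnbrokenSpan

/-- The translate of `h'` by `τ` has the same energy, so the second-order term of the energy
comparison is nonpositive. -/
lemma integral_sq_translate_sub_le (hab : IsUnbrokenSpan L h a b)
    (hBa : Icc (a - ρ) a ⊆ broken L h) (hBb : Icc b (b + ρ) ⊆ broken L h)
    (hW : ContDiffOn ℝ 2 (Wstar W) (Ici 0)) (hL : 0 < L) (hK : h ∈ K L) (hEL : SolvesEL W ε L h)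
    (hC0 : 0 ≤ C) (hC : ∀ y ∈ Icc 0 L, D L h y ≤ R) (hR : 0 ≤ R)
    (hMC : ∀ t ∈ Icc 0 R, |Mstar W t| ≤ C) {τ : ℝ} (hτ : 0 ≤ τ) (hτρ : τ ≤ ρ) :
    ε ^ 2 * ∫ y in (0 : ℝ)..L, (truncDD L h a b (y + τ) - truncDD L h a b y) ^ 2 ≤
      C * (τ ^ 2 * ∫ t, truncDD L h a b t ^ 2) := by
  have hτ' : |τ| ≤ ρ := (abs_of_nonneg hτ).trans_le hτρ
  have ha := hBa ⟨by linarith, le_rfl⟩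
  have hb := hBb ⟨le_rfl, by linarith⟩
  have hq := isComparison_translate hab.lt.le hBa hBb hτ' hK.1 hK.2.2.2 ha.2 hb.2 rfl
  have hmem := truncD_mem_Icc (hab.Icc_subset hL.le) hK.2.2.2 hR hC
  have hle := hq.integral_density_add_quadForm_le hL hW hK hEL hab (m := fun _ => -C)
    continuousOn_const fun y _ t ht => neg_le_of_abs_le
      (hMC t (ordConnected_Icc.uIcc_subset (hmem y) (hmem (y + τ)) ht))
  rw [integral_density_translate hab.lt.le hBa hBb hτ',
    (hq.memH1.sub (hab.memH1_truncD_self hL.le hK.1)).quadForm_eq_add hL.le continuousOn_const,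
    intervalIntegral.integral_const_mul] at hle
  have htranslate := mul_le_mul_of_nonneg_left (InverseFracture.integral_sq_translate_sub_le hL.le
    (memLp_indicator_Icc hK.1.memH1_D.memLp ha.1.1 hb.1.2)
    (hK.1.memH1_D.indicator_sub_eq_integral ha.1.1 hab.lt.le hb.1.2 ha.2 hb.2) hτ) hC0
  simp only [truncD, truncDD] at hle ⊢
  linarith

end IsUnbrokenSpan

lemma translationMode_eq_truncD (hab : IsUnbrokenPart L h a b) :
    translationMode L h a b = truncD L h a b := by
  refine funext fun y => ?_
  by_cases hy : y ∈ broken L h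
  · rw [truncD_eq_zero_of_mem_broken hy]
    exact indicator_apply_eq_zero.2 fun _ => hy.2
  · have hmem : y ∈ Ioo a b ↔ y ∈ Icc a b := by
      refine ⟨fun hy' => Ioo_subset_Icc_self hy', fun hy' => ⟨hy'.1.lt_of_ne ?_, hy'.2.lt_of_ne ?_⟩⟩
      · rintro rfl
        exact hy hab.1.1
      · rintro rfl
        exact hy hab.2.1.1
    by_cases hy' : y ∈ Icc a b
    · rw [translationMode, truncD, indicator_of_mem hy', indicator_of_mem (hmem.2 hy')]
    · rw [translationMode, truncD, indicator_of_notMem hy', indicator_of_notMem (mt hmem.1 hy')]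

namespace IsUnbrokenPart

lemma exists_memH1_primitive (hab : IsUnbrokenPart L h a b)
    (hW : ContDiffOn ℝ 2 (Wstar W) (Ici 0)) (hε : 0 < ε) (hL : 0 < L) (hK : h ∈ K L)
    (hEL : SolvesEL W ε L h) (hnd : NondegenerateCracks L h) :
    ∃ v u, MemH1 L v u ∧ ∀ y ∈ Icc 0 L, truncD L h a b y = ∫ t in (0 : ℝ)..y, v t := by
  obtain ⟨ρ, hρ, hBa, hBb⟩ := hab.exists_margin hnd
  obtain ⟨R, hR, hhR⟩ := exists_bound_D hL.le hK.1
  obtain ⟨C, hC, hMC⟩ := exists_bound_Mstar hW hR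
  have ha := crackFaces_subset_Ioo hnd hab.1
  have hb := crackFaces_subset_Ioo hnd hab.2.1
  have hP0 {y : ℝ} (hy : y ≤ a) : truncD L h a b y = 0 :=
    indicator_apply_eq_zero.2 fun hy' => le_antisymm hy hy'.1 ▸ hab.1.1.2
  have haρ : 0 ≤ a - ρ := (hBa ⟨le_rfl, by linarith⟩).1.1
  set τ : ℕ → ℝ := fun n => ρ / (n + 1)
  have hτ0 (n : ℕ) : 0 < τ n := by positivity
  have hτρ (n : ℕ) : τ n ≤ ρ := div_le_self hρ.le (by linarith [n.cast_nonneg (α := ℝ)])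
  have hτ : Tendsto τ atTop (𝓝[≠] 0) :=
    tendsto_nhdsWithin_iff.2 ⟨(tendsto_const_div_atTop_nhds_zero_nat ρ).comp
      (tendsto_add_atTop_nat 1) |>.congr fun n => by simp [τ],
      Eventually.of_forall fun n => (hτ0 n).ne'⟩
  set A := ∫ t, truncDD L h a b t ^ 2
  have hA : 0 ≤ A := integral_nonneg fun t => sq_nonneg _
  have hzero (n : ℕ) :
      |(τ n)⁻¹ * (truncD L h a b (0 + τ n) - truncD L h a b 0)| ≤ C * A / ε ^ 2 := by
    rw [hP0 (by linarith [hτρ n]), hP0 ha.1.le, sub_zero, mul_zero, abs_zero]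
    exact div_nonneg (mul_nonneg hC hA) (sq_nonneg ε)
  have hbound (n : ℕ) : ∫ y in (0 : ℝ)..L,
      ((τ n)⁻¹ * (truncDD L h a b (y + τ n) - truncDD L h a b y)) ^ 2 ≤ C * A / ε ^ 2 := by
    simp_rw [mul_pow]
    rw [intervalIntegral.integral_const_mul, le_div_iff₀ (by positivity), mul_assoc,
      mul_comm _ (ε ^ 2)]
    refine (mul_le_mul_of_nonneg_left (hab.isUnbrokenSpan.integral_sq_translate_sub_le hBa hBb hW
      hL hK hEL hC hhR hR hMC (hτ0 n).le (hτρ n)) (sq_nonneg _)).trans_eq ?_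
    field_simp [(hτ0 n).ne']
    rfl
  obtain ⟨v, u, hv, hPv⟩ := exists_memH1_of_differenceQuotient hL.le
    (memLp_indicator_Icc hK.1.memH1_D.memLp ha.1.le hb.2.le)
    (hK.1.memH1_D.indicator_sub_eq_integral ha.1.le hab.2.2.1.le hb.2.le hab.1.1.2 hab.2.1.1.2)
    hτ hzero hbound
  exact ⟨v, u, hv, fun y hy => by rw [← hPv y hy, ← truncD, hP0 ha.1.le, sub_zero]⟩

lemma D_truncD_eq_zero (hab : IsUnbrokenPart L h a b) (hnd : NondegenerateCracks L h)
    (hh : ∀ y ∈ Icc 0 L, 0 ≤ D L h y) (hy : y ∈ broken L h) : D L (truncD L h a b) y = 0 := by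
  have ha := crackFaces_subset_Ioo hnd hab.1
  have hb := crackFaces_subset_Ioo hnd hab.2.1
  by_cases hyab : y ∈ Icc a b
  · have hmin : IsLocalMin (truncD L h a b) y := Eventually.of_forall fun t => by
      rw [truncD_eq_zero_of_mem_broken hy]
      exact truncD_nonneg (Icc_subset_Icc ha.1.le hb.2.le) hh t
    rw [D, derivWithin_of_mem_nhds
      (Icc_mem_nhds (ha.1.trans_le hyab.1) (hyab.2.trans_lt hb.2)), hmin.deriv_eq_zero]
  · have hzero : truncD L h a b =ᶠ[𝓝 y] fun _ => 0 :=
      (isClosed_Icc.isOpen_compl.eventually_mem hyab).mono fun t ht => indicator_of_notMem ht _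
    rw [D, (hzero.filter_mono nhdsWithin_le_nhds).derivWithin_eq hzero.eq_of_nhds,
      derivWithin_fun_const, Pi.zero_apply]

theorem translationMode_mem_restrictedVariations (hab : IsUnbrokenPart L h a b)
    (hW : ContDiffOn ℝ 2 (Wstar W) (Ici 0)) (hε : 0 < ε) (hL : 0 < L) (hK : h ∈ K L)
    (hEL : SolvesEL W ε L h) (hnd : NondegenerateCracks L h) :
    translationMode L h a b ∈ restrictedVariations L h := by
  obtain ⟨v, u, hv, hPv⟩ := hab.exists_memH1_primitive hW hε hL hK hEL hnd
  have hD : ∀ y ∈ broken L h, D L (truncD L h a b) y = 0 := fun y =>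
    hab.D_truncD_eq_zero hnd hK.2.2.2
  have hB : ∀ y ∈ broken L h, truncD L h a b y = 0 := fun y => truncD_eq_zero_of_mem_broken
  have ha := crackFaces_subset_Ioo hnd hab.1
  have hb := crackFaces_subset_Ioo hnd hab.2.1
  rw [translationMode_eq_truncD hab]
  exact ⟨⟨⟨hv.memH2_of_eqOn_primitive hL hPv, indicator_of_notMem (fun h0 => ha.1.not_ge h0.1) _,
    indicator_of_notMem (fun hL' => hb.2.not_ge hL'.2) _⟩, fun y hy => (hD y hy).ge,
    fun y hy => hB y hy.1⟩, hD, hB⟩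

end IsUnbrokenPart

end Regularity

/-! ### Compactness and positivity of the second variation -/

section Compactness

variable {L ε B C d y : ℝ} {f : ℕ → ℝ → ℝ} {F g m φ u : ℝ → ℝ}

lemma tendsto_integral_of_bounded (hy : 0 ≤ y) (hc : ∀ n, ContinuousOn (f n) (Icc 0 y))
    (hB : ∀ n, ∀ t ∈ Icc 0 y, |f n t| ≤ B)
    (hF : ∀ t ∈ Icc 0 y, Tendsto (fun n => f n t) atTop (𝓝 (F t))) :
    Tendsto (fun n => ∫ t in (0 : ℝ)..y, f n t) atTop (𝓝 (∫ t in (0 : ℝ)..y, F t)) := by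
  have hsub : uIoc 0 y ⊆ Icc 0 y := uIoc_subset_uIcc.trans_eq (uIcc_of_le hy)
  exact intervalIntegral.tendsto_integral_filter_of_dominated_convergence (fun _ => B)
    (Eventually.of_forall fun n => ((hc n).mono hsub).aestronglyMeasurable measurableSet_uIoc)
    (Eventually.of_forall fun n => Eventually.of_forall fun t ht => hB n t (hsub ht))
    intervalIntegrable_const (Eventually.of_forall fun t ht => hF t (hsub ht))

lemma tendsto_integral_primitive_mul (hL : 0 ≤ L) (hc : ∀ n, ContinuousOn (f n) (Icc 0 L))
    (hB : ∀ n, ∀ t ∈ Icc 0 L, |f n t| ≤ B)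
    (hF : ∀ t ∈ Icc 0 L, Tendsto (fun n => f n t) atTop (𝓝 (F t))) (hg : ContinuousOn g (Icc 0 L)) :
    Tendsto (fun n => ∫ y in (0 : ℝ)..L, (∫ t in (0 : ℝ)..y, f n t) * g y) atTop
      (𝓝 (∫ y in (0 : ℝ)..L, (∫ t in (0 : ℝ)..y, F t) * g y)) := by
  obtain ⟨R, hR⟩ := isCompact_Icc.exists_bound_of_continuousOn hg
  have hB0 : 0 ≤ B := (abs_nonneg _).trans (hB 0 0 (left_mem_Icc.2 hL))
  refine tendsto_integral_of_bounded (B := B * L * R) hL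
    (fun n => ContinuousOn.mul
      (fun y hy => (hasDerivWithinAt_primitive (hc n) hy).continuousWithinAt) hg)
    (fun n y hy => ?_) fun y hy => (tendsto_integral_of_bounded hy.1
      (fun n => (hc n).mono (Icc_subset_Icc_right hy.2))
      (fun n t ht => hB n t ⟨ht.1, ht.2.trans hy.2⟩)
      fun t ht => hF t ⟨ht.1, ht.2.trans hy.2⟩).mul_const _
  have hprim : ‖∫ t in (0 : ℝ)..y, f n t‖ ≤ B * |y - 0| := by
    refine intervalIntegral.norm_integral_le_of_norm_le_const fun t ht => ?_
    rw [uIoc_of_le hy.1] at ht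
    exact hB n t ⟨ht.1.le, ht.2.trans hy.2⟩
  rw [sub_zero, abs_of_nonneg hy.1] at hprim
  rw [abs_mul]
  exact mul_le_mul (hprim.trans (mul_le_mul_of_nonneg_left hy.2 hB0)) (hR y hy) (abs_nonneg _)
    (by positivity)

lemma quadForm_const_mul (ε L c : ℝ) (m φ u : ℝ → ℝ) :
    quadForm ε L m (fun y => c * φ y) (fun y => c * u y) = c ^ 2 * quadForm ε L m φ u := by
  rw [quadForm, quadForm, ← intervalIntegral.integral_const_mul]
  congr 1 with y
  ring

namespace MemH1

lemma quadForm_sub_const (hφ : MemH1 L φ u) (hL : 0 ≤ L) (hm : ContinuousOn m (Icc 0 L)) :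
    quadForm ε L (fun y => m y - d) φ u =
      quadForm ε L m φ u - d * ∫ y in (0 : ℝ)..L, φ y ^ 2 := by
  have hmφ : IntervalIntegrable (fun y => m y * φ y ^ 2) volume 0 L :=
    (hm.mul ((hφ.continuousOn hL).pow 2)).intervalIntegrable_of_Icc hL
  rw [hφ.quadForm_eq_add (m := fun y => m y - d) hL (hm.sub continuousOn_const),
    hφ.quadForm_eq_add hL hm, add_sub_assoc, ← intervalIntegral.integral_const_mul d,
    ← intervalIntegral.integral_sub hmφ ((hφ.intervalIntegrable_sq hL).const_mul d)]
  simp_rw [sub_mul]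

lemma le_quadForm (hφ : MemH1 L φ u) (hL : 0 ≤ L) (hm : ContinuousOn m (Icc 0 L))
    (hC : ∀ y ∈ Icc 0 L, -C ≤ m y) :
    ε ^ 2 * (∫ y in (0 : ℝ)..L, u y ^ 2) - C * (∫ y in (0 : ℝ)..L, φ y ^ 2) ≤
      quadForm ε L m φ u := by
  have hmφ : IntervalIntegrable (fun y => m y * φ y ^ 2) volume 0 L :=
    (hm.mul ((hφ.continuousOn hL).pow 2)).intervalIntegrable_of_Icc hL
  have hmono := intervalIntegral.integral_mono_on hL
    ((hφ.intervalIntegrable_sq hL).const_mul (-C)) hmφ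
    fun y hy => mul_le_mul_of_nonneg_right (hC y hy) (sq_nonneg _)
  rw [intervalIntegral.integral_const_mul] at hmono
  rw [hφ.quadForm_eq_add hL hm]
  linarith

lemma exists_normalization (hφ : MemH1 L φ u) (hL : 0 ≤ L) (hm : ContinuousOn m (Icc 0 L))
    (hneg : quadForm ε L (fun y => m y - d) φ u < 0) :
    ∃ c : ℝ, ∫ y in (0 : ℝ)..L, (c * φ y) ^ 2 = 1 ∧
      quadForm ε L m (fun y => c * φ y) (fun y => c * u y) ≤ d := by
  obtain ⟨C, hC⟩ := isCompact_Icc.exists_bound_of_continuousOn hm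
  have hsq {f : ℝ → ℝ} : 0 ≤ ∫ y in (0 : ℝ)..L, f y ^ 2 :=
    intervalIntegral.integral_nonneg hL fun _ _ => sq_nonneg _
  rw [hφ.quadForm_sub_const hL hm] at hneg
  have hlower := hφ.le_quadForm (ε := ε) hL hm fun y hy => neg_le_of_abs_le (hC y hy)
  have hpos : 0 < ∫ y in (0 : ℝ)..L, φ y ^ 2 := by
    refine hsq.lt_of_ne fun h0 => ?_
    rw [← h0] at hneg hlower
    linarith [mul_nonneg (sq_nonneg ε) (hsq (f := u))]
  have hc : (√(∫ y in (0 : ℝ)..L, φ y ^ 2))⁻¹ ^ 2 * ∫ y in (0 : ℝ)..L, φ y ^ 2 = 1 := by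
    rw [inv_pow, Real.sq_sqrt hsq, inv_mul_cancel₀ hpos.ne']
  refine ⟨(√(∫ y in (0 : ℝ)..L, φ y ^ 2))⁻¹, ?_, ?_⟩
  · simp_rw [mul_pow]
    rw [intervalIntegral.integral_const_mul, hc]
  · rw [quadForm_const_mul]
    calc _ ≤ (√(∫ y in (0 : ℝ)..L, φ y ^ 2))⁻¹ ^ 2 * (d * ∫ y in (0 : ℝ)..L, φ y ^ 2) :=
          mul_le_mul_of_nonneg_left (by linarith) (sq_nonneg _)
      _ = d := by rw [mul_left_comm, hc, mul_one]

end MemH1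

variable {φ u : ℕ → ℝ → ℝ} {d : ℕ → ℝ}

lemma exists_bound_of_quadForm_le (hL : 0 < L) (hε : 0 < ε) (hm : ContinuousOn m (Icc 0 L))
    (hφ : ∀ n, MemH1 L (φ n) (u n)) (hone : ∀ n, ∫ y in (0 : ℝ)..L, φ n y ^ 2 = 1)
    (hd : ∀ n, quadForm ε L m (φ n) (u n) ≤ C) :
    ∃ B, (∀ n, ∀ y ∈ Icc 0 L, |φ n y| ≤ B) ∧ ∀ n, ∫ y in (0 : ℝ)..L, u n y ^ 2 ≤ B := by
  obtain ⟨M, hM⟩ := isCompact_Icc.exists_bound_of_continuousOn hm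
  have hu (n : ℕ) : ∫ y in (0 : ℝ)..L, u n y ^ 2 ≤ (C + M) / ε ^ 2 := by
    have hlower := (hφ n).le_quadForm (ε := ε) hL.le hm fun y hy => neg_le_of_abs_le (hM y hy)
    rw [hone, mul_one] at hlower
    rw [le_div_iff₀' (by positivity)]
    linarith [hd n]
  refine ⟨max (√((2 + 2 * L ^ 2 * ((C + M) / ε ^ 2)) / L)) ((C + M) / ε ^ 2),
    fun n y hy => le_max_of_le_left (Real.abs_le_sqrt ?_), fun n => le_max_of_le_right (hu n)⟩
  rw [le_div_iff₀' hL]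
  refine ((hφ n).mul_sq_le hy).trans ?_
  rw [hone, mul_one]
  gcongr
  exact hu n

theorem exists_subseq_quadForm_le_zero (hL : 0 < L) (hε : 0 < ε) (hm : ContinuousOn m (Icc 0 L))
    (hφ : ∀ n, MemH1 L (φ n) (u n)) (hone : ∀ n, ∫ y in (0 : ℝ)..L, φ n y ^ 2 = 1)
    (hd : Tendsto d atTop (𝓝 0)) (hφd : ∀ n, quadForm ε L m (φ n) (u n) ≤ d n) :
    ∃ (σ : ℕ → ℕ) (B : ℝ) (p w : ℝ → ℝ), StrictMono σ ∧ MemH1 L p w ∧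
      (∀ n, ∀ y ∈ Icc 0 L, |φ n y| ≤ B) ∧
      (∀ y ∈ Icc 0 L, Tendsto (fun n => φ (σ n) y) atTop (𝓝 (p y))) ∧
      ∫ y in (0 : ℝ)..L, p y ^ 2 = 1 ∧ quadForm ε L m p w ≤ 0 := by
  obtain ⟨M, hM⟩ := isCompact_Icc.exists_bound_of_continuousOn hm
  obtain ⟨C, hC⟩ := hd.bddAbove_range
  obtain ⟨B, hφB, huB⟩ := exists_bound_of_quadForm_le hL hε hm hφ hone
    fun n => (hφd n).trans (hC (mem_range_self n))
  obtain ⟨σ, p, w, hσ, hp, hlim, hlsc⟩ :=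
    exists_subseq_memH1 hL.le hφ (fun n => hφB n 0 (left_mem_Icc.2 hL.le)) huB
  have hsq (n : ℕ) : ContinuousOn (fun y => φ (σ n) y ^ 2) (Icc 0 L) :=
    ((hφ _).continuousOn hL.le).pow 2
  have hsqB (n : ℕ) {y : ℝ} (hy : y ∈ Icc 0 L) : |φ (σ n) y ^ 2| ≤ B ^ 2 := by
    rw [abs_pow]
    exact pow_le_pow_left₀ (abs_nonneg _) (hφB _ y hy) 2
  refine ⟨σ, B, p, w, hσ, hp, hφB, hlim, ?_, ?_⟩
  · refine tendsto_nhds_unique (tendsto_integral_of_bounded hL.le hsq (fun n y hy => hsqB n hy)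
      fun y hy => (hlim y hy).pow 2) ?_
    simp_rw [hone]
    exact tendsto_const_nhds
  · have hpotential := tendsto_integral_of_bounded (f := fun n y => m y * φ (σ n) y ^ 2)
      (B := M * B ^ 2) hL.le
      (fun n => hm.mul (hsq n)) (fun n y hy => by
        rw [abs_mul]
        exact mul_le_mul (hM y hy) (hsqB n hy) (abs_nonneg _) ((norm_nonneg _).trans (hM y hy)))
      (fun y hy => ((hlim y hy).pow 2).const_mul (m y))
    have hw := hlsc _ _ (((hd.comp hσ.tendsto_atTop).sub hpotential).div_const (ε ^ 2)) fun n => by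
      rw [le_div_iff₀' (by positivity)]
      have hle := hφd (σ n)
      rw [(hφ _).quadForm_eq_add hL.le hm] at hle
      exact le_sub_iff_add_le.2 hle
    rw [le_div_iff₀' (by positivity)] at hw
    rw [hp.quadForm_eq_add hL.le hm]
    linarith

end Compactness

/-- The second variation is positive on the nonzero restricted variations which are orthogonal to
all translation modes. -/
def PositiveModuloTranslations (W : ℝ → ℝ) (ε L : ℝ) (h : ℝ → ℝ) : Prop :=
  ∀ η ∈ restrictedVariations L h, (∃ y ∈ Icc 0 L, η y ≠ 0) →
    (∀ r s, IsUnbrokenPart L h r s → ∫ y in (0 : ℝ)..L, η y * translationMode L h r s y = 0) →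
    0 < secondVariation W ε L h η

/-- The slope `φ`, with derivative `u`, of a variation which is supported within distance `s` of
`[a,b]`, has second variation at most `s`, and is normalized in `L²`. If `(a,b)` lies between two
cracks, the variation itself, `∫₀ʸ φ`, is orthogonal to the translation mode. -/
structure IsUnstableSlope (W : ℝ → ℝ) (ε L : ℝ) (h : ℝ → ℝ) (a b s : ℝ) (φ u : ℝ → ℝ) : Prop where
  memH1 : MemH1 L φ u
  support : ∀ y ∈ Icc 0 L, y ∉ Icc (a - s) (b + s) → φ y = 0
  integral_eq_zero : ∫ y in (0 : ℝ)..L, φ y = 0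
  integral_sq : ∫ y in (0 : ℝ)..L, φ y ^ 2 = 1
  orthogonal : a ∈ crackFaces L h → b ∈ crackFaces L h →
    ∫ y in (0 : ℝ)..L, (∫ t in (0 : ℝ)..y, φ t) * truncD L h a b y = 0
  quadForm_le : quadForm ε L (fun y => Mstar W (truncD L h a b y)) φ u ≤ s

/-- A slope `q` at distance at most `e` from `h'` whose energy is smaller than that of `h` on
`[a,b]`, orthogonal to the translation mode in the sense of `IsUnstableSlope`. -/
structure IsCompetitor (W : ℝ → ℝ) (ε L : ℝ) (h : ℝ → ℝ) (a b e : ℝ) (q z : ℝ → ℝ) : Prop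
    extends IsComparison L h a b q z where
  close : ∀ y ∈ Icc 0 L, |q y - truncD L h a b y| ≤ e
  support : ∀ y ∈ Icc 0 L, y ∉ Icc (a - e) (b + e) → q y = 0
  energy_lt : ∫ y in (0 : ℝ)..L, density W ε q z y <
    ∫ y in a..b, density W ε (D L h) (D L (D L h)) y
  orthogonal : a ∈ crackFaces L h → b ∈ crackFaces L h →
    ∫ y in (0 : ℝ)..L, (∫ t in (0 : ℝ)..y, (q t - truncD L h a b t)) * truncD L h a b y = 0

section Positivity

variable {W : ℝ → ℝ} {ε L : ℝ} {h : ℝ → ℝ} {a b r s y R : ℝ} {p w η : ℝ → ℝ}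

lemma primitive_eq_zero_of_notMem_Ioo (hL : 0 ≤ L) (hpc : ContinuousOn p (Icc 0 L))
    (hsupp : ∀ y ∈ Icc 0 L, y ∉ Icc a b → p y = 0) (hint : ∫ y in (0 : ℝ)..L, p y = 0)
    (hy : y ∈ Icc 0 L) (hyab : y ∉ Ioo a b) : ∫ t in (0 : ℝ)..y, p t = 0 := by
  rcases le_or_gt y a with hya | hya
  · rw [intervalIntegral.integral_of_le hy.1, integral_Ioc_eq_integral_Ioo]
    exact setIntegral_eq_zero_of_forall_eq_zero fun t ht =>
      hsupp t ⟨ht.1.le, ht.2.le.trans hy.2⟩ fun hab => (ht.2.trans_le hya).not_ge hab.1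
  · have hyb : b ≤ y := le_of_not_gt fun hyb => hyab ⟨hya, hyb⟩
    have hpi : IntervalIntegrable p volume 0 L := hpc.intervalIntegrable_of_Icc hL
    have hyL : y ∈ uIcc 0 L := by rwa [uIcc_of_le hL]
    rw [← intervalIntegral.integral_add_adjacent_intervals
      (hpi.mono_set (uIcc_subset_uIcc_left hyL)) (hpi.mono_set (uIcc_subset_uIcc_right hyL)),
      intervalIntegral.integral_of_le hy.2, setIntegral_eq_zero_of_forall_eq_zero fun t ht =>
        hsupp t ⟨hy.1.trans ht.1.le, ht.2⟩ fun hab => (hyb.trans_lt ht.1).not_ge hab.2,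
      add_zero] at hint
    exact hint

lemma secondVariation_primitive (hL : 0 < L) (hp : MemH1 L p w)
    (hsupp : ∀ y ∈ Icc 0 L, y ∉ Icc a b → p y = 0) :
    secondVariation W ε L h (fun y => ∫ t in (0 : ℝ)..y, p t) =
      quadForm ε L (fun y => Mstar W (truncD L h a b y)) p w := by
  rw [secondVariation, quadForm, intervalIntegral_eq_restrict_Icc hL.le,
    intervalIntegral_eq_restrict_Icc hL.le]
  refine integral_congr_ae ?_
  filter_upwards [hp.D_D_primitive hL, ae_restrict_mem measurableSet_Icc] with y hyD hy
  rw [hyD, D_primitive hL (hp.continuousOn hL.le) hy]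
  by_cases hyab : y ∈ Icc a b
  · rw [truncD, indicator_of_mem hyab]
  · rw [hsupp y hy hyab]
    ring

namespace IsUnbrokenSpan

lemma eq_zero_of_mem_broken (hab : IsUnbrokenSpan L h a b) (hnd : NondegenerateCracks L h)
    (hpc : ContinuousOn p (Icc 0 L)) (hsupp : ∀ y ∈ Icc 0 L, y ∉ Icc a b → p y = 0)
    (hy : y ∈ broken L h) : p y = 0 := by
  by_cases hyab : y ∈ Icc a b
  · rcases hyab.1.eq_or_lt with rfl | hay
    · have ha := crackFaces_subset_Ioo hnd (hab.left_mem_crackFaces hy)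
      have hzero : EqOn p (fun _ => 0) (Ico 0 a) := fun t ht =>
        hsupp t ⟨ht.1, (ht.2.trans ha.2).le⟩ fun htab => ht.2.not_ge htab.1
      exact hzero.of_subset_closure (hpc.mono (Icc_subset_Icc_right ha.2.le)) continuousOn_const
        Ico_subset_Icc_self (closure_Ico ha.1.ne).ge (right_mem_Icc.2 ha.1.le)
    rcases hyab.2.eq_or_lt with rfl | hyb
    · have hb := crackFaces_subset_Ioo hnd (hab.right_mem_crackFaces hy)
      have hzero : EqOn p (fun _ => 0) (Ioc y L) := fun t ht =>
        hsupp t ⟨(hb.1.trans ht.1).le, ht.2⟩ fun htab => ht.1.not_ge htab.2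
      exact hzero.of_subset_closure (hpc.mono (Icc_subset_Icc_left hb.1.le)) continuousOn_const
        Ioc_subset_Icc_self (closure_Ioc hb.2.ne).ge (left_mem_Icc.2 hb.2.le)
    · exact absurd hy (hab.subset_good ⟨hay, hyb⟩).2
  · exact hsupp y hy.1 hyab

lemma primitive_mem_restrictedVariations (hab : IsUnbrokenSpan L h a b) (hL : 0 < L)
    (hnd : NondegenerateCracks L h) (hp : MemH1 L p w)
    (hsupp : ∀ y ∈ Icc 0 L, y ∉ Icc a b → p y = 0) (hint : ∫ y in (0 : ℝ)..L, p y = 0) :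
    (fun y => ∫ t in (0 : ℝ)..y, p t) ∈ restrictedVariations L h := by
  have hpc := hp.continuousOn hL.le
  have hD : ∀ y ∈ broken L h, D L (fun y => ∫ t in (0 : ℝ)..y, p t) y = 0 := fun y hy => by
    rw [D_primitive hL hpc hy.1, hab.eq_zero_of_mem_broken hnd hpc hsupp hy]
  have hB : ∀ y ∈ broken L h, ∫ t in (0 : ℝ)..y, p t = 0 := fun y hy =>
    primitive_eq_zero_of_notMem_Ioo hL.le hpc hsupp hint hy.1
      fun hyab => (hab.subset_good hyab).2 hy
  exact ⟨⟨⟨hp.memH2_of_eqOn_primitive hL (eqOn_refl _ _), intervalIntegral.integral_same, hint⟩,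
    fun y hy => (hD y hy).ge, fun y hy => hB y hy.1⟩, hD, hB⟩

lemma integral_mul_translationMode_eq_zero (hab : IsUnbrokenSpan L h a b) (hL : 0 ≤ L)
    (hη : ∀ y ∈ Icc 0 L, y ∉ Ioo a b → η y = 0)
    (horth : a ∈ crackFaces L h → b ∈ crackFaces L h →
      ∫ y in (0 : ℝ)..L, η y * truncD L h a b y = 0) (hrs : IsUnbrokenPart L h r s) :
    ∫ y in (0 : ℝ)..L, η y * translationMode L h r s y = 0 := by
  by_cases hmeet : ∃ y, y ∈ Ioo r s ∧ y ∈ Ioo a b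
  · obtain ⟨y, hyrs, hyab⟩ := hmeet
    obtain ⟨rfl, rfl⟩ := hab.eq_of_not_disjoint hL hrs.isUnbrokenSpan hyab hyrs
    rw [translationMode_eq_truncD hrs]
    exact horth hrs.1 hrs.2.1
  · refine (intervalIntegral.integral_congr fun y hy => ?_).trans intervalIntegral.integral_zero
    rw [uIcc_of_le hL] at hy
    by_cases hyrs : y ∈ Ioo r s
    · simp only [hη y hy fun hyab => hmeet ⟨y, hyrs, hyab⟩, zero_mul]
    · simp only [translationMode, indicator_of_notMem hyrs, mul_zero]

end IsUnbrokenSpan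

lemma PositiveModuloTranslations.not_isUnstableSlope_zero
    (hpos : PositiveModuloTranslations W ε L h) (hL : 0 < L) (hnd : NondegenerateCracks L h)
    (hab : IsUnbrokenSpan L h a b) : ¬ IsUnstableSlope W ε L h a b 0 p w := by
  rintro ⟨hp, hsupp, hint, hsq, horth, hform⟩
  rw [sub_zero, add_zero] at hsupp
  have hpc := hp.continuousOn hL.le
  rw [← secondVariation_primitive hL hp hsupp] at hform
  refine hform.not_gt (hpos _ (hab.primitive_mem_restrictedVariations hL hnd hp hsupp hint) ?_
    fun r s hrs => hab.integral_mul_translationMode_eq_zero hL.le (fun y hy hyab =>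
      primitive_eq_zero_of_notMem_Ioo hL.le hpc hsupp hint hy hyab) horth hrs)
  by_contra! hη
  have hp0 : ∀ y ∈ uIcc 0 L, p y ^ 2 = 0 := fun y hy => by
    rw [uIcc_of_le hL.le] at hy
    rw [← D_primitive hL hpc hy, D_congr (f := fun x => ∫ t in (0 : ℝ)..x, p t)
      (g := fun _ => 0) hη hy, D, derivWithin_fun_const, Pi.zero_apply, zero_pow two_ne_zero]
  rw [intervalIntegral.integral_congr hp0, intervalIntegral.integral_zero] at hsq
  exact zero_ne_one hsq

namespace IsUnbrokenSpan

variable (hab : IsUnbrokenSpan L h a b) (hL : 0 < L)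
include hab hL

lemma continuousOn_Mstar_truncD (hW : ContDiffOn ℝ 2 (Wstar W) (Ici 0)) (hK : h ∈ K L) :
    ContinuousOn (fun y => Mstar W (truncD L h a b y)) (Icc 0 L) :=
  (continuousOn_Mstar hW).comp ((hab.memH1_truncD_self hL.le hK.1).continuousOn hL.le)
    fun y _ => truncD_nonneg (hab.Icc_subset hL.le) hK.2.2.2 y

lemma exists_isUnstableSlope_zero (hW : ContDiffOn ℝ 2 (Wstar W) (Ici 0)) (hε : 0 < ε)
    (hK : h ∈ K L) (hs : ∀ s > 0, ∃ φ u, IsUnstableSlope W ε L h a b s φ u) :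
    ∃ p w, IsUnstableSlope W ε L h a b 0 p w := by
  choose φ u hφ using fun n : ℕ => hs (1 / (n + 1)) Nat.one_div_pos_of_nat
  have hd : Tendsto (fun n : ℕ => 1 / ((n : ℝ) + 1)) atTop (𝓝 0) :=
    tendsto_one_div_add_atTop_nhds_zero_nat
  obtain ⟨σ, B, p, w, hσ, hp, hB, hlim, hsq, hform⟩ := exists_subseq_quadForm_le_zero hL hε
    (hab.continuousOn_Mstar_truncD hL hW hK) (fun n => (hφ n).memH1) (fun n => (hφ n).integral_sq)
    hd fun n => (hφ n).quadForm_le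
  have hφc (n : ℕ) : ContinuousOn (φ (σ n)) (Icc 0 L) := (hφ _).memH1.continuousOn hL.le
  refine ⟨p, w, hp, fun y hy hyab => ?_, ?_, hsq, fun ha hb => ?_, hform⟩
  · rw [sub_zero, add_zero] at hyab
    have hout : ∀ᶠ s in 𝓝 (0 : ℝ), y ∉ Icc (a - s) (b + s) := by
      rcases not_and_or.1 hyab with hya | hyb
      · filter_upwards [gt_mem_nhds (sub_pos.2 (not_le.1 hya))] with s hs' hmem
        linarith [hmem.1]
      · filter_upwards [gt_mem_nhds (sub_pos.2 (not_le.1 hyb))] with s hs' hmem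
        linarith [hmem.2]
    refine tendsto_nhds_unique (hlim y hy) (tendsto_const_nhds.congr' ?_)
    filter_upwards [(hd.comp hσ.tendsto_atTop).eventually hout] with n hn
    exact ((hφ _).support y hy hn).symm
  · refine tendsto_nhds_unique (tendsto_integral_of_bounded hL.le hφc (fun n => hB (σ n)) hlim) ?_
    simp_rw [(hφ _).integral_eq_zero]
    exact tendsto_const_nhds
  · refine tendsto_nhds_unique (tendsto_integral_primitive_mul hL.le hφc (fun n => hB (σ n)) hlim
      ((hab.memH1_truncD_self hL.le hK.1).continuousOn hL.le)) ?_
    simp_rw [(hφ _).orthogonal ha hb]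
    exact tendsto_const_nhds

end IsUnbrokenSpan

lemma exists_forall_sub_le_Mstar (hW : ContDiffOn ℝ 2 (Wstar W) (Ici 0)) (R : ℝ) (hs : 0 < s) :
    ∃ δ > 0, ∀ x ∈ Icc 0 R, ∀ t, 0 ≤ t → |t - x| ≤ δ → Mstar W x - s ≤ Mstar W t := by
  obtain ⟨δ, hδ, hM⟩ := Metric.uniformContinuousOn_iff.1
    (isCompact_Icc.uniformContinuousOn_of_continuous
      ((continuousOn_Mstar hW).mono (Icc_subset_Ici_self : Icc 0 (R + 1) ⊆ Ici 0))) s hs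
  refine ⟨min (δ / 2) 1, by positivity, fun x hx t ht htx => ?_⟩
  have hlt := hM x ⟨hx.1, by linarith [hx.2]⟩ t
    ⟨ht, by linarith [hx.2, le_of_abs_le htx, min_le_right (δ / 2) 1]⟩
    (by rw [dist_comm, Real.dist_eq]; linarith [min_le_left (δ / 2) 1])
  rw [Real.dist_eq] at hlt
  linarith [le_of_abs_le hlt.le]

lemma IsCompetitor.mono {e e' : ℝ} {q z : ℝ → ℝ} (hq : IsCompetitor W ε L h a b e q z)
    (he : e ≤ e') : IsCompetitor W ε L h a b e' q z :=
  { hq with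
    close := fun y hy => (hq.close y hy).trans he
    support := fun y hy hyab => hq.support y hy fun hy' =>
      hyab ⟨by linarith [hy'.1], by linarith [hy'.2]⟩ }

lemma IsCompetitor.isUnstableSlope {q z : ℝ → ℝ} {c : ℝ} (hq : IsCompetitor W ε L h a b s q z)
    (hL : 0 < L) (hh : MemH2 L h) (hab : IsUnbrokenSpan L h a b) (hs : 0 ≤ s)
    (hone : ∫ y in (0 : ℝ)..L, (c * (q y - truncD L h a b y)) ^ 2 = 1)
    (hle : quadForm ε L (fun y => Mstar W (truncD L h a b y))
      (fun y => c * (q y - truncD L h a b y)) (fun y => c * (z y - truncDD L h a b y)) ≤ s) :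
    IsUnstableSlope W ε L h a b s (fun y => c * (q y - truncD L h a b y))
      (fun y => c * (z y - truncDD L h a b y)) where
  memH1 := (hq.memH1.sub (hab.memH1_truncD_self hL.le hh)).const_mul c
  support y hy hyab := by
    rw [hq.support y hy hyab, truncD, indicator_of_notMem fun hy' =>
      hyab ⟨by linarith [hy'.1], by linarith [hy'.2]⟩, sub_zero, mul_zero]
  integral_eq_zero := by
    rw [intervalIntegral.integral_const_mul,
      hq.toIsComparison.integral_sub_eq_zero hL.le hh hab, mul_zero]
  integral_sq := hone
  orthogonal ha hb := by
    simp_rw [intervalIntegral.integral_const_mul, mul_assoc]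
    rw [intervalIntegral.integral_const_mul, hq.orthogonal ha hb, mul_zero]
  quadForm_le := hle

/-- The energy of a competitor is smaller than that of `h`, so the second-order term of the energy
comparison is negative. -/
lemma exists_isUnstableSlope (hW : ContDiffOn ℝ 2 (Wstar W) (Ici 0)) (hL : 0 < L) (hK : h ∈ K L)
    (hEL : SolvesEL W ε L h) (hab : IsUnbrokenSpan L h a b)
    (hcomp : ∀ e > 0, ∃ q z, IsCompetitor W ε L h a b e q z) (hs : 0 < s) :
    ∃ φ u, IsUnstableSlope W ε L h a b s φ u := by
  obtain ⟨R, hR, hhR⟩ := exists_bound_D hL.le hK.1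
  have hmem := truncD_mem_Icc (hab.Icc_subset hL.le) hK.2.2.2 hR hhR
  have hm := hab.continuousOn_Mstar_truncD hL hW hK
  obtain ⟨δ, hδ, hM⟩ := exists_forall_sub_le_Mstar hW R hs
  obtain ⟨q, z, hq⟩ := hcomp (min s δ) (lt_min hs hδ)
  have hMt : ∀ y ∈ Icc 0 L, ∀ t ∈ uIcc (truncD L h a b y) (q y),
      Mstar W (truncD L h a b y) - s ≤ Mstar W t := fun y hy t ht =>
    hM _ (hmem y) t (ordConnected_Ici.uIcc_subset (hmem y).1 (hq.nonneg y hy) ht)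
      ((abs_sub_left_of_mem_uIcc ht).trans ((hq.close y hy).trans (min_le_right _ _)))
  have hle := hq.toIsComparison.integral_density_add_quadForm_le hL hW hK hEL hab
    (m := fun y => Mstar W (truncD L h a b y) - s) (hm.sub continuousOn_const) hMt
  obtain ⟨c, hone, hform⟩ := (hq.memH1.sub (hab.memH1_truncD_self hL.le hK.1)).exists_normalization
    (ε := ε) hL.le hm (by linarith [hq.energy_lt])
  exact ⟨_, _, (hq.mono (min_le_left _ _)).isUnstableSlope hL hK.1 hab hs.le hone hform⟩

theorem PositiveModuloTranslations.exists_not_isCompetitor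
    (hpos : PositiveModuloTranslations W ε L h) (hW : ContDiffOn ℝ 2 (Wstar W) (Ici 0))
    (hε : 0 < ε) (hL : 0 < L) (hK : h ∈ K L) (hEL : SolvesEL W ε L h)
    (hnd : NondegenerateCracks L h) (hab : IsUnbrokenSpan L h a b) :
    ∃ e > 0, ∀ q z, ¬ IsCompetitor W ε L h a b e q z := by
  by_contra! hcomp
  obtain ⟨p, w, hp⟩ := hab.exists_isUnstableSlope_zero hL hW hε hK fun s hs =>
    exists_isUnstableSlope hW hL hK hEL hab hcomp hs
  exact hpos.not_isUnstableSlope_zero hL hnd hab hp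

end Positivity

/-! ### Orthogonality by translation -/

/-- The pairing with `P` of the displacement whose slope is `Q(· + τ) - P`. For `P` the slope of `h`
between two cracks and `Q` the slope of a competitor, it vanishes when the competitor, moved by `τ`,
differs from `h` by a variation orthogonal to the translation mode. -/
def shiftPairing (L : ℝ) (P Q : ℝ → ℝ) (τ : ℝ) : ℝ :=
  ∫ y in (0 : ℝ)..L, (∫ t in (0 : ℝ)..y, (Q (t + τ) - P t)) * P y

section Shift

variable {L c s ρ τ x y R : ℝ} {P Q : ℝ → ℝ}

lemma integral_translate_sub (hP : Continuous P) (hQ : Continuous Q) (τ y : ℝ) :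
    ∫ t in (0 : ℝ)..y, (Q (t + τ) - P t) =
      (∫ t in (0 : ℝ)..(y + τ), Q t) - (∫ t in (0 : ℝ)..τ, Q t) - ∫ t in (0 : ℝ)..y, P t := by
  rw [intervalIntegral.integral_sub (Continuous.intervalIntegrable (by fun_prop) _ _)
    (hP.intervalIntegrable _ _), intervalIntegral.integral_comp_add_right Q, zero_add,
    intervalIntegral.integral_interval_sub_left (hQ.intervalIntegrable _ _)
      (hQ.intervalIntegrable _ _)]

lemma continuous_uncurry_integral_translate_mul (hP : Continuous P) (hQ : Continuous Q) :
    Continuous (Function.uncurry fun τ y => (∫ t in (0 : ℝ)..y, (Q (t + τ) - P t)) * P y) := by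
  have hprimQ : Continuous fun y => ∫ t in (0 : ℝ)..y, Q t :=
    intervalIntegral.continuous_primitive (fun c d => hQ.intervalIntegrable c d) 0
  have hprimP : Continuous fun y => ∫ t in (0 : ℝ)..y, P t :=
    intervalIntegral.continuous_primitive (fun c d => hP.intervalIntegrable c d) 0
  simp_rw [integral_translate_sub hP hQ]
  exact (((hprimQ.comp (continuous_snd.add continuous_fst)).sub (hprimQ.comp continuous_fst)).sub
    (hprimP.comp continuous_snd)).mul (hP.comp continuous_snd)

lemma continuous_integral_translate_mul (hP : Continuous P) (hQ : Continuous Q) (τ : ℝ) :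
    Continuous fun y => (∫ t in (0 : ℝ)..y, (Q (t + τ) - P t)) * P y :=
  (continuous_uncurry_integral_translate_mul hP hQ).comp (Continuous.prodMk_right τ)

lemma continuous_shiftPairing (hP : Continuous P) (hQ : Continuous Q) :
    Continuous (shiftPairing L P Q) :=
  intervalIntegral.continuous_parametric_intervalIntegral_of_continuous'
    (continuous_uncurry_integral_translate_mul hP hQ) 0 L

lemma mul_integral_translate_sub_self (hP : Continuous P) (hc : ∀ y ≤ c, P y = 0) (hτ : |τ| ≤ c)
    (y : ℝ) : τ * ∫ t in (0 : ℝ)..y, (P (t + τ) - P t) =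
      τ ^ 2 * ∫ t in (0 : ℝ)..1, P (y + τ * t) := by
  have hzero : ∫ t in (0 : ℝ)..τ, P t = 0 := by
    refine (intervalIntegral.integral_congr fun t ht => hc t ?_).trans
      intervalIntegral.integral_zero
    have ht' := abs_sub_left_of_mem_uIcc ht
    rw [sub_zero, sub_zero] at ht'
    exact (le_abs_self t).trans (ht'.trans hτ)
  rw [integral_translate_sub hP hP, hzero, sub_zero, intervalIntegral.integral_interval_sub_left
    (hP.intervalIntegrable _ _) (hP.intervalIntegrable _ _), sq, mul_assoc,
    intervalIntegral.mul_integral_comp_add_mul, mul_zero, mul_one, add_zero]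

lemma mul_shiftPairing_self_pos (hL : 0 < L) (hP : Continuous P) (hP0 : ∀ y, 0 ≤ P y)
    (hc : ∀ y ≤ c, P y = 0) (hx : x ∈ Icc 0 L) (hPx : 0 < P x) (hτ : |τ| ≤ c) (hτ0 : τ ≠ 0) :
    0 < τ * shiftPairing L P P τ := by
  have hτ2 : 0 < τ ^ 2 := by positivity
  rw [shiftPairing, ← intervalIntegral.integral_const_mul]
  refine intervalIntegral.integral_pos hL
    ((continuous_integral_translate_mul hP hP τ).const_mul τ).continuousOn (fun y _ => ?_)
    ⟨x, hx, ?_⟩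
  · rw [← mul_assoc, mul_integral_translate_sub_self hP hc hτ]
    exact mul_nonneg (mul_nonneg hτ2.le
      (intervalIntegral.integral_nonneg zero_le_one fun t _ => hP0 _)) (hP0 y)
  · rw [← mul_assoc, mul_integral_translate_sub_self hP hc hτ]
    refine mul_pos (mul_pos hτ2 (intervalIntegral.integral_pos zero_lt_one
      (Continuous.continuousOn (by fun_prop)) (fun t _ => hP0 _)
      ⟨0, left_mem_Icc.2 zero_le_one, ?_⟩)) hPx
    rwa [mul_zero, add_zero]

lemma abs_shiftPairing_sub_le (hL : 0 ≤ L) (hP : Continuous P) (hQ : Continuous Q)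
    (hR : ∀ y ∈ Icc 0 L, |P y| ≤ R) (hs : ∀ y, |Q y - P y| ≤ s) (τ : ℝ) :
    |shiftPairing L P Q τ - shiftPairing L P P τ| ≤ s * L * R * L := by
  have hs0 : 0 ≤ s := (abs_nonneg _).trans (hs 0)
  rw [shiftPairing, shiftPairing, ← intervalIntegral.integral_sub
    ((continuous_integral_translate_mul hP hQ τ).intervalIntegrable _ _)
    ((continuous_integral_translate_mul hP hP τ).intervalIntegrable _ _)]
  have hle : ∀ y ∈ uIoc 0 L, ‖(∫ t in (0 : ℝ)..y, (Q (t + τ) - P t)) * P y -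
      (∫ t in (0 : ℝ)..y, (P (t + τ) - P t)) * P y‖ ≤ s * L * R := fun y hy => by
    rw [uIoc_of_le hL] at hy
    rw [← sub_mul, ← intervalIntegral.integral_sub (Continuous.intervalIntegrable (by fun_prop) _ _)
      (Continuous.intervalIntegrable (by fun_prop) _ _), norm_mul]
    simp_rw [sub_sub_sub_cancel_right]
    have hinner := intervalIntegral.norm_integral_le_of_norm_le_const (a := 0) (b := y)
      (f := fun t => Q (t + τ) - P (t + τ)) fun t _ => hs (t + τ)
    rw [sub_zero, abs_of_pos hy.1] at hinner
    exact mul_le_mul (hinner.trans (mul_le_mul_of_nonneg_left hy.2 hs0)) (hR y ⟨hy.1.le, hy.2⟩)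
      (norm_nonneg _) (mul_nonneg hs0 hL)
  simpa only [sub_zero, abs_of_nonneg hL, Real.norm_eq_abs] using
    intervalIntegral.norm_integral_le_of_norm_le_const hle

/-- Moving `P` to the left or to the right gives the pairing either sign, so for `Q` close to `P`
the intermediate value theorem provides the translation. -/
theorem exists_shiftPairing_eq_zero (hL : 0 < L) (hP : Continuous P) (hP0 : ∀ y, 0 ≤ P y)
    (hρ : 0 < ρ) (hPρ : ∀ y ≤ ρ, P y = 0) (hx : x ∈ Icc 0 L) (hPx : 0 < P x) :
    ∃ s > 0, ∀ Q : ℝ → ℝ, Continuous Q → (∀ y, |Q y - P y| ≤ s) →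
      ∃ τ, |τ| ≤ ρ ∧ shiftPairing L P Q τ = 0 := by
  obtain ⟨R, hR⟩ := isCompact_Icc.exists_bound_of_continuousOn (hP.continuousOn (s := Icc 0 L))
  have hplus : 0 < shiftPairing L P P ρ := pos_of_mul_pos_right
    (mul_shiftPairing_self_pos hL hP hP0 hPρ hx hPx (abs_of_pos hρ).le hρ.ne') hρ.le
  have hminus : shiftPairing L P P (-ρ) < 0 := by
    have hpos := mul_shiftPairing_self_pos hL hP hP0 hPρ hx hPx
      ((abs_neg ρ).trans (abs_of_pos hρ)).le (neg_ne_zero.2 hρ.ne')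
    rw [neg_mul_comm] at hpos
    exact neg_pos.1 (pos_of_mul_pos_right hpos hρ.le)
  have hlim : Tendsto (fun s => s * L * R * L) (𝓝[>] 0) (𝓝 0) :=
    tendsto_nhdsWithin_of_tendsto_nhds ((by fun_prop :
      Continuous fun s : ℝ => s * L * R * L).tendsto' 0 0 (by ring))
  obtain ⟨s, ⟨hs₁, hs₂⟩, hs⟩ := ((hlim.eventually (gt_mem_nhds hplus)).and
    (hlim.eventually (gt_mem_nhds (neg_pos.2 hminus)))).and self_mem_nhdsWithin |>.exists
  refine ⟨s, hs, fun Q hQ hQP => ?_⟩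
  have hclose := abs_shiftPairing_sub_le hL.le hP hQ hR hQP
  have hQplus : 0 ≤ shiftPairing L P Q ρ := by linarith [neg_le_of_abs_le (hclose ρ)]
  have hQminus : shiftPairing L P Q (-ρ) ≤ 0 := by linarith [le_of_abs_le (hclose (-ρ))]
  obtain ⟨τ, hτ, hτ0⟩ := intermediate_value_Icc (by linarith : -ρ ≤ ρ)
    (continuous_shiftPairing hP hQ).continuousOn ⟨hQminus, hQplus⟩
  exact ⟨τ, abs_le.2 hτ, hτ0⟩

end Shift

/-! ### Local stability -/

/-- `h` minimizes the energy on `[a,b]` among all `g ∈ K` in an `H²`-ball around `h` that are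
reached from `h` by an admissible variation; for `[0,L]` this is `LocallyStable`. -/
def LocallyStableOn (W : ℝ → ℝ) (ε L : ℝ) (h : ℝ → ℝ) (a b : ℝ) : Prop :=
  ∃ δ > 0, ∀ g ∈ K L, g - h ∈ admissibleVariations L h → H2norm L (g - h) < δ →
    ∫ y in a..b, density W ε (D L h) (D L (D L h)) y ≤
      ∫ y in a..b, density W ε (D L g) (D L (D L g)) y

section Stability

variable {W P : ℝ → ℝ} {ε L : ℝ} {g h : ℝ → ℝ} {a b e s x y ρ τ : ℝ}

lemma exists_abs_D_le_H2norm (hL : 0 < L) :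
    ∃ κ > 0, ∀ η, MemH2 L η → ∀ y ∈ Icc 0 L, |D L η y| ≤ κ * H2norm L η := by
  refine ⟨√((2 + 2 * L ^ 2) / L), by positivity, fun η hη y hy => ?_⟩
  have hD := hη.memH1_D
  have hη2 : IntervalIntegrable (fun y => η y ^ 2) volume 0 L :=
    (hη.differentiableOn.continuousOn.pow 2).intervalIntegrable_of_Icc hL.le
  have hD2 := hD.intervalIntegrable_sq hL.le
  have hDD2 := hD.intervalIntegrable_deriv_sq (left_mem_Icc.2 hL.le) (right_mem_Icc.2 hL.le)
  have hsq (f : ℝ → ℝ) : 0 ≤ ∫ y in (0 : ℝ)..L, f y ^ 2 :=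
    intervalIntegral.integral_nonneg hL.le fun _ _ => sq_nonneg _
  rw [H2norm, ← Real.sqrt_mul (by positivity)]
  refine Real.abs_le_sqrt ?_
  rw [intervalIntegral.integral_add (hη2.add hD2) hDD2, intervalIntegral.integral_add hη2 hD2,
    div_mul_eq_mul_div, le_div_iff₀' hL]
  refine (hD.mul_sq_le hy).trans ?_
  nlinarith [hsq η, hsq (D L η), hsq (D L (D L η)), mul_nonneg (sq_nonneg L) (hsq η),
    mul_nonneg (sq_nonneg L) (hsq (D L η))]

lemma intervalIntegrable_density_D (hW : ContDiffOn ℝ 2 (Wstar W) (Ici 0)) (hL : 0 ≤ L)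
    (hg : g ∈ K L) (hx : x ∈ Icc 0 L) (hy : y ∈ Icc 0 L) :
    IntervalIntegrable (density W ε (D L g) (D L (D L g))) volume x y :=
  (hg.1.memH1_D.intervalIntegrable_density hL hW hg.2.2.2).mono_set
    ((uIcc_subset_Icc hx hy).trans_eq (uIcc_of_le hL).symm)

lemma integral_D_eq_of_mem_fixedPoints (hL : 0 ≤ L) (hg : MemH2 L g) (hh : MemH2 L h)
    (hη : g - h ∈ admissibleVariations L h) (ha : a ∈ fixedPoints L h) (hb : b ∈ fixedPoints L h) :
    ∫ y in a..b, D L g y = ∫ y in a..b, D L h y := by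
  have haL := fixedPoints_subset_Icc hL ha
  have hbL := fixedPoints_subset_Icc hL hb
  have hga : (g - h) a = 0 := eq_zero_of_mem_fixedPoints hη ha
  have hgb : (g - h) b = 0 := eq_zero_of_mem_fixedPoints hη hb
  rw [← hg.sub_eq_integral_D haL hbL, ← hh.sub_eq_integral_D haL hbL, sub_eq_zero.1 hga,
    sub_eq_zero.1 hgb]

lemma D_eq_zero_of_sub_mem_admissibleVariations (hL : 0 ≤ L) (hg : MemH2 L g) (hh : MemH2 L h)
    (hnd : NondegenerateCracks L h) (hη : g - h ∈ admissibleVariations L h)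
    (hy : y ∈ crackFaces L h) : D L g y = 0 := by
  have hD := D_eq_zero_of_mem_crackFaces hL hh hnd hη hy
  rwa [hg.D_sub hh hy.1.1, hy.1.2, sub_zero] at hD

lemma abs_truncD_sub_le (hs : 0 ≤ s) (hab : Icc a b ⊆ Icc 0 L)
    (hgh : ∀ y ∈ Icc 0 L, |D L g y - D L h y| ≤ s) (y : ℝ) :
    |truncD L g a b y - truncD L h a b y| ≤ s := by
  by_cases hy : y ∈ Icc a b
  · simpa only [truncD, indicator_of_mem hy] using hgh y (hab hy)
  · simpa only [truncD, indicator_of_notMem hy, sub_zero, abs_zero] using hs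

lemma exists_forall_abs_translate_sub_le (hP : Continuous P) (L : ℝ) (he : 0 < e) :
    ∃ ρ > 0, ∀ τ, |τ| ≤ ρ → ∀ y ∈ Icc 0 L, |P (y + τ) - P y| ≤ e := by
  obtain ⟨δ, hδ, hunif⟩ := Metric.uniformContinuousOn_iff.1
    ((isCompact_Icc (a := -1) (b := L + 1)).uniformContinuousOn_of_continuous hP.continuousOn) e he
  refine ⟨min (δ / 2) 1, by positivity, fun τ hτ y hy => ?_⟩
  obtain ⟨hτ1, hτ2⟩ := abs_le.1 (hτ.trans (min_le_right _ _))
  exact (hunif (y + τ) ⟨by linarith [hy.1], by linarith [hy.2]⟩ y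
    ⟨by linarith [hy.1], by linarith [hy.2]⟩ (by
      rw [Real.dist_eq, add_sub_cancel_left]
      linarith [hτ.trans (min_le_left _ _)])).le

/-- A span which touches an end of the bar carries no translation mode, so no translation is
needed. -/
lemma IsUnbrokenSpan.isCompetitor_truncD (hab : IsUnbrokenSpan L h a b) (hL : 0 ≤ L) (hK : h ∈ K L)
    (hnd : NondegenerateCracks L h) (hcrack : ¬(a ∈ crackFaces L h ∧ b ∈ crackFaces L h))
    (he : 0 ≤ e) (hg : g ∈ K L) (hη : g - h ∈ admissibleVariations L h)
    (hgh : ∀ y ∈ Icc 0 L, |D L g y - D L h y| ≤ e)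
    (hlt : ∫ y in a..b, density W ε (D L g) (D L (D L g)) y <
      ∫ y in a..b, density W ε (D L h) (D L (D L h)) y) :
    IsCompetitor W ε L h a b e (truncD L g a b) (truncDD L g a b) where
  memH1 := hab.memH1_truncD hL hg.1 fun _ =>
    D_eq_zero_of_sub_mem_admissibleVariations hL hg.1 hK.1 hnd hη
  nonneg y _ := truncD_nonneg (hab.Icc_subset hL) hg.2.2.2 y
  integral_eq := by
    rw [truncD, integral_indicator_Icc (fixedPoints_subset_Icc hL hab.left_mem).1 hab.lt.le
      (fixedPoints_subset_Icc hL hab.right_mem).2,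
      integral_D_eq_of_mem_fixedPoints hL hg.1 hK.1 hη hab.left_mem hab.right_mem]
  eq_zero_or_broken _ _ hy := Or.inr ⟨indicator_of_notMem hy _, indicator_of_notMem hy _⟩
  close y _ := abs_truncD_sub_le he (hab.Icc_subset hL) hgh y
  support _ _ hy := indicator_of_notMem
    (fun hm => hy ⟨by linarith [hm.1], by linarith [hm.2]⟩) _
  energy_lt := by rwa [hab.integral_density_truncD hL]
  orthogonal ha hb := absurd ⟨ha, hb⟩ hcrack

namespace IsUnbrokenPart

lemma continuous_truncD (hab : IsUnbrokenPart L h a b) (hg : MemH2 L g) (hga : D L g a = 0)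
    (hgb : D L g b = 0) : Continuous (truncD L g a b) := by
  have ha := hab.1.1.1.1
  have hb := hab.2.1.1.1.2
  refine ((intervalIntegral.continuous_primitive (fun x y => intervalIntegrable_of_memLp
    (memLp_indicator_Icc hg.memH1_D.memLp ha hb) x y) 0).add_const (truncD L g a b 0)).congr
    fun y => ?_
  rw [← hg.memH1_D.indicator_sub_eq_integral ha hab.2.2.1.le hb hga hgb]
  exact sub_add_cancel _ _

lemma truncD_pos (hab : IsUnbrokenPart L h a b) (hK : h ∈ K L) (hy : y ∈ Ioo a b) :
    0 < truncD L h a b y := by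
  have hyG := hab.2.2.2 hy
  rw [truncD, indicator_of_mem (Ioo_subset_Icc_self hy)]
  exact (hK.2.2.2 y hyG.1).lt_of_ne fun h0 => hyG.2 ⟨hyG.1, h0.symm⟩

lemma truncD_eq_zero_of_le (hab : IsUnbrokenPart L h a b) (hy : y ≤ a) : truncD L h a b y = 0 := by
  rcases hy.eq_or_lt with rfl | hy
  · exact truncD_eq_zero_of_mem_broken hab.1.1
  · exact indicator_of_notMem (fun hy' => hy.not_ge hy'.1) _

lemma isCompetitor_translate (hab : IsUnbrokenPart L h a b) (hL : 0 ≤ L) (hK : h ∈ K L)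
    (hnd : NondegenerateCracks L h) (hBa : Icc (a - ρ) a ⊆ broken L h)
    (hBb : Icc b (b + ρ) ⊆ broken L h) (hτρ : |τ| ≤ ρ) (hτe : |τ| ≤ e) (hg : g ∈ K L)
    (hη : g - h ∈ admissibleVariations L h)
    (hclose : ∀ y ∈ Icc 0 L, |truncD L g a b (y + τ) - truncD L h a b y| ≤ e)
    (hlt : ∫ y in a..b, density W ε (D L g) (D L (D L g)) y <
      ∫ y in a..b, density W ε (D L h) (D L (D L h)) y)
    (horth : shiftPairing L (truncD L h a b) (truncD L g a b) τ = 0) :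
    IsCompetitor W ε L h a b e (fun y => truncD L g a b (y + τ))
      (fun y => truncDD L g a b (y + τ)) where
  toIsComparison := isComparison_translate hab.2.2.1.le hBa hBb hτρ hg.1 hg.2.2.2
    (D_eq_zero_of_sub_mem_admissibleVariations hL hg.1 hK.1 hnd hη hab.1)
    (D_eq_zero_of_sub_mem_admissibleVariations hL hg.1 hK.1 hnd hη hab.2.1)
    (integral_D_eq_of_mem_fixedPoints hL hg.1 hK.1 hη hab.isUnbrokenSpan.left_mem
      hab.isUnbrokenSpan.right_mem)
  close := hclose
  support _ _ hy := by
    obtain ⟨hτ1, hτ2⟩ := abs_le.1 hτe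
    exact indicator_of_notMem (fun hm => hy ⟨by linarith [hm.1], by linarith [hm.2]⟩) _
  energy_lt := by rwa [integral_density_translate hab.2.2.1.le hBa hBb hτρ]
  orthogonal _ _ := horth

lemma exists_isCompetitor (hab : IsUnbrokenPart L h a b) (hL : 0 < L) (hK : h ∈ K L)
    (hnd : NondegenerateCracks L h) (he : 0 < e) :
    ∃ s > 0, ∀ g ∈ K L, g - h ∈ admissibleVariations L h →
      (∀ y ∈ Icc 0 L, |D L g y - D L h y| ≤ s) →
      ∫ y in a..b, density W ε (D L g) (D L (D L g)) y <
        ∫ y in a..b, density W ε (D L h) (D L (D L h)) y →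
      ∃ q z, IsCompetitor W ε L h a b e q z := by
  have hsub := hab.isUnbrokenSpan.Icc_subset hL.le
  have hPc := hab.continuous_truncD hK.1 hab.1.1.2 hab.2.1.1.2
  obtain ⟨ρ₀, hρ₀, hBa, hBb⟩ := hab.exists_margin hnd
  obtain ⟨ρ₁, hρ₁, hunif⟩ := exists_forall_abs_translate_sub_le hPc (L + ρ₀) (half_pos he)
  have hρa : ρ₀ ≤ a := sub_nonneg.1 (hBa ⟨le_rfl, by linarith⟩).1.1
  have hmid : (a + b) / 2 ∈ Ioo a b := ⟨by linarith [hab.2.2.1], by linarith [hab.2.2.1]⟩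
  obtain ⟨s, hs, hshift⟩ := exists_shiftPairing_eq_zero hL hPc (truncD_nonneg hsub hK.2.2.2)
    (lt_min hρ₀ (lt_min hρ₁ he)) (fun y hy => hab.truncD_eq_zero_of_le
      (hy.trans ((min_le_left _ _).trans hρa))) (hsub (Ioo_subset_Icc_self hmid))
    (hab.truncD_pos hK hmid)
  refine ⟨min s (e / 2), lt_min hs (half_pos he), fun g hg hη hgh hlt => ?_⟩
  have hD0 {y : ℝ} (hy : y ∈ crackFaces L h) : D L g y = 0 :=
    D_eq_zero_of_sub_mem_admissibleVariations hL.le hg.1 hK.1 hnd hη hy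
  have htrunc := abs_truncD_sub_le (lt_min hs (half_pos he)).le hsub hgh
  obtain ⟨τ, hτ, horth⟩ := hshift (truncD L g a b)
    (hab.continuous_truncD hg.1 (hD0 hab.1) (hD0 hab.2.1))
    fun y => (htrunc y).trans (min_le_left _ _)
  obtain ⟨hτ₀, hτ₁, hτe⟩ : |τ| ≤ ρ₀ ∧ |τ| ≤ ρ₁ ∧ |τ| ≤ e := by simpa only [le_min_iff] using hτ
  refine ⟨_, _, hab.isCompetitor_translate hL.le hK hnd hBa hBb hτ₀ hτe hg hη (fun y hy => ?_) hlt
    horth⟩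
  calc |truncD L g a b (y + τ) - truncD L h a b y|
      ≤ |truncD L g a b (y + τ) - truncD L h a b (y + τ)| +
          |truncD L h a b (y + τ) - truncD L h a b y| := abs_sub_le _ _ _
    _ ≤ e / 2 + e / 2 := add_le_add ((htrunc _).trans (min_le_right _ _))
        (hunif τ hτ₁ y ⟨hy.1, hy.2.trans (by linarith)⟩)
    _ = e := add_halves e

end IsUnbrokenPart

lemma IsUnbrokenSpan.locallyStableOn (hab : IsUnbrokenSpan L h a b)
    (hpos : PositiveModuloTranslations W ε L h) (hW : ContDiffOn ℝ 2 (Wstar W) (Ici 0))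
    (hε : 0 < ε) (hL : 0 < L) (hK : h ∈ K L) (hEL : SolvesEL W ε L h)
    (hnd : NondegenerateCracks L h) : LocallyStableOn W ε L h a b := by
  obtain ⟨e, he, hnone⟩ := hpos.exists_not_isCompetitor hW hε hL hK hEL hnd hab
  obtain ⟨κ, hκ, hsup⟩ := exists_abs_D_le_H2norm hL
  obtain ⟨s, hs, hcomp⟩ : ∃ s > 0, ∀ g ∈ K L, g - h ∈ admissibleVariations L h →
      (∀ y ∈ Icc 0 L, |D L g y - D L h y| ≤ s) →
      ∫ y in a..b, density W ε (D L g) (D L (D L g)) y <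
        ∫ y in a..b, density W ε (D L h) (D L (D L h)) y →
      ∃ q z, IsCompetitor W ε L h a b e q z := by
    by_cases hcrack : a ∈ crackFaces L h ∧ b ∈ crackFaces L h
    · exact IsUnbrokenPart.exists_isCompetitor ⟨hcrack.1, hcrack.2, hab.lt, hab.subset_good⟩
        hL hK hnd he
    · exact ⟨e, he, fun g hg hη hgh hlt =>
        ⟨_, _, hab.isCompetitor_truncD hL.le hK hnd hcrack he.le hg hη hgh hlt⟩⟩
  refine ⟨s / κ, by positivity, fun g hg hη hδ => ?_⟩
  by_contra! hlt
  have hgh : ∀ y ∈ Icc 0 L, |D L g y - D L h y| ≤ s := fun y hy => by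
    rw [← hg.1.D_sub hK.1 hy]
    exact (hsup _ hη.1.1 y hy).trans ((lt_div_iff₀' hκ).1 hδ).le
  obtain ⟨q, z, hq⟩ := hcomp g hg hη hgh hlt
  exact hnone q z hq

/-- Admissible variations have zero slope on a broken interval with fixed ends, so they leave
`W*(h')` unchanged there. -/
lemma locallyStableOn_of_broken (hW : ContDiffOn ℝ 2 (Wstar W) (Ici 0)) (hL : 0 ≤ L) (hK : h ∈ K L)
    (ha : a ∈ fixedPoints L h) (hb : b ∈ fixedPoints L h) (hab : a < b)
    (hB : Ioo a b ⊆ broken L h) : LocallyStableOn W ε L h a b := by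
  refine ⟨1, one_pos, fun g hg hη _ => ?_⟩
  have haL := fixedPoints_subset_Icc hL ha
  have hbL := fixedPoints_subset_Icc hL hb
  refine intervalIntegral.integral_mono_ae_restrict hab.le
    (intervalIntegrable_density_D hW hL hK haL hbL)
    (intervalIntegrable_density_D hW hL hg haL hbL) ?_
  rw [← restrict_Ioo_eq_restrict_Icc]
  filter_upwards [ae_restrict_of_ae (ae_D_D_eq_zero L h), ae_restrict_mem measurableSet_Ioo]
    with y hDD hy
  have hD := D_eq_zero_of_Ioo_subset_broken hL hK.1 hη ha hb hab hB (Ioo_subset_Icc_self hy)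
  rw [hg.1.D_sub hK.1 (hB hy).1, sub_eq_zero] at hD
  rw [density, density, hDD (hB hy), hD, zero_pow two_ne_zero, mul_zero, zero_add]
  exact le_add_of_nonneg_left (by positivity)

lemma integral_le_integral_of_finite {S : Set ℝ} {f₁ f₂ : ℝ → ℝ} (hS : S.Finite) (h0 : 0 ∈ S)
    (hSL : S ⊆ Icc 0 L) (hf₁ : IntervalIntegrable f₁ volume 0 L)
    (hf₂ : IntervalIntegrable f₂ volume 0 L)
    (hle : ∀ x ∈ S, ∀ y ∈ S, x < y → (∀ t ∈ Ioo x y, t ∉ S) → ∫ t in x..y, f₁ t ≤ ∫ t in x..y, f₂ t)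
    (hy : y ∈ S) : ∫ t in (0 : ℝ)..y, f₁ t ≤ ∫ t in (0 : ℝ)..y, f₂ t := by
  have hsub {x y : ℝ} (hx : x ∈ S) (hy : y ∈ S) : uIcc x y ⊆ uIcc 0 L :=
    uIcc_subset_uIcc (Icc_subset_uIcc (hSL hx)) (Icc_subset_uIcc (hSL hy))
  refine (hS.wellFoundedOn (r := (· < ·))).induction
    (P := fun y => ∫ t in (0 : ℝ)..y, f₁ t ≤ ∫ t in (0 : ℝ)..y, f₂ t) hy fun y hy ih => ?_
  rcases (hSL hy).1.eq_or_lt with rfl | hy0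
  · simp only [intervalIntegral.integral_same, le_refl]
  obtain ⟨x, hx, hxy, hno⟩ := exists_last_lt_of_finite hS h0 hy0
  rw [← intervalIntegral.integral_add_adjacent_intervals (hf₁.mono_set (hsub h0 hx))
    (hf₁.mono_set (hsub hx hy)), ← intervalIntegral.integral_add_adjacent_intervals
    (hf₂.mono_set (hsub h0 hx)) (hf₂.mono_set (hsub hx hy))]
  exact add_le_add (ih x hx hxy) (hle x hx y hy hxy hno)

lemma locallyStable_of_forall_locallyStableOn (hW : ContDiffOn ℝ 2 (Wstar W) (Ici 0)) (hL : 0 ≤ L)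
    (hK : h ∈ K L) (hnd : NondegenerateCracks L h)
    (hst : ∀ a ∈ fixedPoints L h, ∀ b ∈ fixedPoints L h, a < b →
      (∀ t ∈ Ioo a b, t ∉ fixedPoints L h) → LocallyStableOn W ε L h a b) :
    LocallyStable W ε L h := by
  have hfin := finite_fixedPoints hL hK.1 hnd
  have hδ : ∀ᶠ δ in 𝓝[>] (0 : ℝ), ∀ x ∈ fixedPoints L h ×ˢ fixedPoints L h, x.1 < x.2 →
      (∀ t ∈ Ioo x.1 x.2, t ∉ fixedPoints L h) → ∀ g ∈ K L, g - h ∈ admissibleVariations L h →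
      H2norm L (g - h) < δ → ∫ y in x.1..x.2, density W ε (D L h) (D L (D L h)) y ≤
        ∫ y in x.1..x.2, density W ε (D L g) (D L (D L g)) y := by
    rw [eventually_all_finite (hfin.prod hfin)]
    rintro x ⟨hx₁, hx₂⟩
    by_cases hgap : x.1 < x.2 ∧ ∀ t ∈ Ioo x.1 x.2, t ∉ fixedPoints L h
    · obtain ⟨δ, hδ, hmin⟩ := hst _ hx₁ _ hx₂ hgap.1 hgap.2
      filter_upwards [Ioo_mem_nhdsGT hδ] with d hd _ _ g hg hη hlt
      exact hmin g hg hη (hlt.trans hd.2)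
    · exact Eventually.of_forall fun _ hlt hno => absurd ⟨hlt, hno⟩ hgap
  obtain ⟨δ, hmin, hδ0⟩ := (hδ.and self_mem_nhdsWithin).exists
  have h0L := left_mem_Icc.2 hL
  have hLL := right_mem_Icc.2 hL
  exact ⟨δ, hδ0, fun g hg hη hlt => integral_le_integral_of_finite hfin (zero_mem_fixedPoints L h)
    (fixedPoints_subset_Icc hL) (intervalIntegrable_density_D hW hL hK h0L hLL)
    (intervalIntegrable_density_D hW hL hg h0L hLL)
    (fun x hx y hy hxy hno => hmin (x, y) ⟨hx, hy⟩ hxy hno g hg hη hlt) (right_mem_fixedPoints L h)⟩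

end Stability

end InverseFracture

end

open InverseFracture in
theorem theorem3p5_general (W : ℝ → ℝ) (ε L : ℝ)
    (hWstar : ContDiffOn ℝ 2 (Wstar W) (Set.Ici 0)) (hε : 0 < ε) (hL : 0 < L)
    (h : ℝ → ℝ) (hK : h ∈ K L) (hEL : SolvesEL W ε L h) (hnd : NondegenerateCracks L h) :
    (∀ r s, IsUnbrokenPart L h r s → translationMode L h r s ∈ restrictedVariations L h) ∧
    ((∀ η ∈ restrictedVariations L h, (∃ y ∈ Set.Icc 0 L, η y ≠ 0) →
        (∀ r s, IsUnbrokenPart L h r s →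
          ∫ y in (0 : ℝ)..L, η y * translationMode L h r s y = 0) →
        0 < secondVariation W ε L h η) →
      LocallyStable W ε L h) := by
  refine ⟨fun _ _ hrs => hrs.translationMode_mem_restrictedVariations hWstar hε hL hK hEL hnd,
    fun hpos => locallyStable_of_forall_locallyStableOn hWstar hL.le hK hnd
      fun a ha b hb hab hgap => ?_⟩
  have hnocrack : ∀ t ∈ Ioo a b, t ∉ crackFaces L h :=
    fun t ht htC => hgap t ht (crackFaces_subset_fixedPoints L h htC)
  rcases Ioo_subset_broken_or_good hL.le hK.1 (fixedPoints_subset_Icc hL.le ha).1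
    (fixedPoints_subset_Icc hL.le hb).2 hnocrack with hB | hG
  · exact locallyStableOn_of_broken hWstar hL.le hK ha hb hab hB
  · exact IsUnbrokenSpan.locallyStableOn ⟨ha, hb, hab, hG⟩ hpos hWstar hε hL hK hEL hnd

open InverseFracture in
theorem theorem3p5 (W : ℝ → ℝ) (γ ε L : ℝ) (hW : IsBrittleEnergy W γ)
    (hWstar : ContDiffOn ℝ 2 (Wstar W) (Set.Ici 0)) (hε : 0 < ε) (hL : 0 < L)
    (h : ℝ → ℝ) (hK : h ∈ K L) (hEL : SolvesEL W ε L h) (hnd : NondegenerateCracks L h) :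
    (∀ r s, IsUnbrokenPart L h r s → translationMode L h r s ∈ restrictedVariations L h) ∧
    ((∀ η ∈ restrictedVariations L h, (∃ y ∈ Set.Icc 0 L, η y ≠ 0) →
        (∀ r s, IsUnbrokenPart L h r s →
          ∫ y in (0 : ℝ)..L, η y * translationMode L h r s y = 0) →
        0 < secondVariation W ε L h η) →
      LocallyStable W ε L h) :=
  theorem3p5_general W ε L hWstar hε hL h hK hEL hnd
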